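/- Let $k$ be an algebraically closed field and let $X$ be a connected reduced proper curve over $k$ that is the union of three smooth (integral) curves $X_1,X_2,X_3$, where $X_1,X_2$ meet transversally at exactly one point $A$, $X_2,X_3$ meet transversally at exactly one point $B\ne A$, and $X_1\cap X_3=\emptyset$. For a component $X_q$ let $X_q^c$ be the union of the other two. Put $t_1=(-1,1,0)$, $t_2=(1,-2,1)$, $t_3=(0,1,-1)$. Fix integers $d,r\ge 0$; a *multidegree* is a triple $\underline d=(i,d-i-l,l)$ of nonnegative integers. For every multidegree $\underline d$ let $\mathcal L_{\underline d}$ be an invertible sheaf on $X$ of degrees $\underline d$ on $(X_1,X_2,X_3)$, and for all multidegrees $\underline d,\ \underline d'=\underline d+t_q$ let $\varphi_{\underline d,\underline d'}:\mathcal L_{\underline d}\to\mathcal L_{\underline d'}$ and $\varphi_{\underline d',\underline d}:\mathcal L_{\underline d'}\to\mathcal L_{\underline d}$ be maps such that 1. $\varphi_{\underline d,\underline d'}$ factors as $\mathcal L_{\underline d}\to\mathcal L_{\underline d}|_{X_q^c}\cong\mathcal L_{\underline d'}|_{X_q^c}(-X_q\cap X_q^c)\hookrightarrow\mathcal L_{\underline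 d'}$ (restriction, an isomorphism, natural inclusion); 2. $\varphi_{\underline d',\underline d}$ factors as $\mathcal L_{\underline d'}\to\mathcal L_{\underline d'}|_{X_q}\cong\mathcal L_{\underline d}|_{X_q}(-X_q\cap X_q^c)\hookrightarrow\mathcal L_{\underline d}$; 3. $\varphi_{\underline d^2,\underline d^3}\circ\varphi_{\underline d^1,\underline d^2}=\varphi_{\underline d^1,\underline d^3}$ whenever $\underline d^2=\underline d^1+t_{q_1}$, $\underline d^3=\underline d^2+t_{q_2}$, $q_1\ne q_2$. For arbitrary multidegrees $\underline d^0\neq\underline d$, the map $\varphi_{\underline d^0,\underline d}:H^0(X,\mathcal L_{\underline d^0})\to H^0(X,\mathcal L_{\underline d})$ is the composite of these maps along any path of multidegrees from $\underline d^0$ to $\underline d$, each step adding or subtracting some $t_q$, that does not add all three $t_q$, does not both add and subtract the same $t_q$, and does not subtract two different $t_q$ (such paths exist and all give the same map); $\varphi_{\underline d,\underline d}=\mathrm{id}$. A *limit linear series* of degree $d$ and dimension $r$ consists of such sheaves and maps together with $(r+1)$-dimensional subspaces $V_{\underline d}\subseteq H^0(X,\mathcal L_{\underline d})$ with $\varphi_{\underline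 d,\underline d'}(V_{\underline d})\subseteq V_{\underline d'}$ and $\varphi_{\underline d',\underline d}(V_{\underline d'})\subseteq V_{\underline d}$ for all multidegrees $\underline d,\ \underline d'=\underline d+t_q$. For $Y\subseteq X$ write $V_{\underline d}^{Y,0}$ for the subspace of sections in $V_{\underline d}$ that vanish on $Y$. The series is *exact* if always $\varphi_{\underline d,\underline d'}(V_{\underline d})=V_{\underline d'}^{X_q,0}$ and $\varphi_{\underline d',\underline d}(V_{\underline d'})=V_{\underline d}^{X_q^c,0}$. *Distributivity holds* in $V_{\underline d}$ if $V_{\underline d}^{X_1,0}\cap(V_{\underline d}^{X_2,0}+V_{\underline d}^{X_3,0})=V_{\underline d}^{X_1,0}\cap V_{\underline d}^{X_2,0}+V_{\underline d}^{X_1,0}\cap V_{\underline d}^{X_3,0}$. A *simple basis* consists of distinct multidegrees $\underline d^1,\dots,\underline d^m$ and linearly independent sections $s^\alpha_1,\dots,s^\alpha_{r_\alpha}\in V_{\underline d^\alpha}$ for each $\alpha$ such that, for every multidegree $\underline d$, the family of all $\varphi_{\underline d^\alpha,\underline d}(s^\alpha_z)$ is a basis of $V_{\underline d}$. The series is *simple*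 if it has a simple basis. **Proposition.** An exact limit linear series in which distributivity holds in $V_{\underline d}$ for every multidegree $\underline d$ is simple. Moreover, let $\underline d^1,\dots,\underline d^m$ be the distinct multidegrees $\underline d$ with $V_{\underline d}^{X_1,0}+V_{\underline d}^{X_2,0}+V_{\underline d}^{X_3,0}\ne V_{\underline d}$, and for each $\alpha$ let $s^\alpha_1,\dots,s^\alpha_{r_\alpha}$ be any basis of any complement of $V_{\underline d^\alpha}^{X_1,0}+V_{\underline d^\alpha}^{X_2,0}+V_{\underline d^\alpha}^{X_3,0}$ in $V_{\underline d^\alpha}$. Then these multidegrees and sections form a simple basis. -/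

import Mathlib

open AlgebraicGeometry CategoryTheory TopologicalSpace Opposite

universe u

noncomputable section

namespace LLS

/-! ### Sections of sheaves of modules on a scheme -/

section Sections

variable {X : Scheme.{u}}

/-- The stalk `M_x` of a sheaf of `𝒪_X`-modules is a module over the local ring `𝒪_{X,x}`. -/
instance stalkModule (M : X.Modules) (x : X) :
    Module (X.presheaf.stalk x) ((Scheme.Modules.presheaf M).stalk x) :=
  PresheafOfModules.instModuleCarrierStalkCommRingCatCarrierAbPresheafOpensCarrier
    (R := X.presheaf) M.val x

lemma germ_smul (M : X.Modules) (U : X.Opens) (x : X) (hx : x ∈ U) (a : Γ(X, U)) (s : Γ(M, U)) :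
    (Scheme.Modules.presheaf M).germ U x hx (a • s) =
      X.presheaf.germ U x hx a • (Scheme.Modules.presheaf M).germ U x hx s :=
  PresheafOfModules.germ_smul (R := X.presheaf) M.val x U hx a s

/-- Restriction of sections to a smaller open set. -/
def res (M : X.Modules) {U V : X.Opens} (h : V ≤ U) (s : Γ(M, U)) : Γ(M, V) :=
  (Scheme.Modules.presheaf M).map (homOfLE h).op s

/-- The value of `s` in the fibre `M_x / 𝔪_x M_x` is zero. -/
def VanishesAt (M : X.Modules) {U : X.Opens} (s : Γ(M, U)) (x : X) (hx : x ∈ U) : Prop :=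
  (Scheme.Modules.presheaf M).germ U x hx s ∈
    (IsLocalRing.maximalIdeal (X.presheaf.stalk x) •
      (⊤ : Submodule (X.presheaf.stalk x) ((Scheme.Modules.presheaf M).stalk x)))

/-- `s` vanishes on (the part inside `U` of) the set `Z`. When `M` is invertible and `Z` is closed,
this says that the restriction of `s` to `Z` with its reduced structure is zero. -/
def VanishesOn (M : X.Modules) {U : X.Opens} (s : Γ(M, U)) (Z : Set X) : Prop :=
  ∀ (x : X) (hx : x ∈ U), x ∈ Z → VanishesAt M s x hx

/-- `e` generates `M` freely over `V`: multiplication by `e` is an isomorphism `𝒪_V ≅ M|_V`. -/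
def IsGenerator (M : X.Modules) {V : X.Opens} (e : Γ(M, V)) : Prop :=
  ∀ (W : X.Opens) (h : W ≤ V), Function.Bijective (fun a : Γ(X, W) => a • res M h e)

/-- Invertible sheaves: `𝒪_X`-modules that are locally free of rank one. -/
def IsInvertible (M : X.Modules) : Prop :=
  ∀ x : X, ∃ V : X.Opens, x ∈ V ∧ ∃ e : Γ(M, V), IsGenerator M e

/-- For reduced closed subsets `Z`, `W` of `X`, the map `φ` factors as
`M → M|_Z ≅ ker (N → N|_W) ↪ N`, the first map being the restriction and the last the inclusion.
Since `M → M|_Z` is surjective, such an isomorphism in the middle exists, and is unique, exactly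
when `φ` has the kernel of `M → M|_Z` as its kernel and the kernel of `N → N|_W` as its image.
The kernel of `N → N|_W` is the sheaf of sections of `N` vanishing on `W`; if `X` is the union of
`Z` and `W` it is `N|_Z(-Z ∩ W)`. -/
structure FactorsThrough {M N : X.Modules} (φ : M ⟶ N) (Z W : Set X) : Prop where
  ker : ∀ (U : X.Opens) (s : Γ(M, U)), φ.app U s = 0 ↔ VanishesOn M s Z
  image : ∀ (U : X.Opens) (t : Γ(N, U)), VanishesOn N t W ↔
    ∀ x ∈ U, ∃ (V : X.Opens) (h : V ≤ U), x ∈ V ∧ ∃ s : Γ(M, V), φ.app V s = res N h t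

end Sections

/-! ### Degrees of invertible sheaves on curves -/

section Degree

variable {X Y : Scheme.{u}} [IsIntegral Y] [IsLocallyNoetherian Y] (ι : Y ⟶ X) (L : X.Modules)

/-- Let `s` be a section of the invertible sheaf `L` over an open set `U` that contains the image
of the generic point of `Y`; it restricts to a rational section of `ι^* L`. This says that
the order of that rational section at the point `y` is `n`: if `e` generates `L` near `ι y` and
`s = g e` where both are defined, then the rational function `ι^# g` on `Y` has order `n` at `y`. -/
def HasOrderAt {U : X.Opens} (s : Γ(L, U)) (y : Y) (n : ℤ) : Prop :=
  ∃ (V : X.Opens) (_ : ι y ∈ V) (e : Γ(L, V)) (g : Γ(X, U ⊓ V))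
    (hη : genericPoint Y ∈ ι ⁻¹ᵁ (U ⊓ V)),
    IsGenerator L e ∧
    res L inf_le_left s = g • res L inf_le_right e ∧
    Scheme.ord (Y.presheaf.germ _ (genericPoint Y) hη (ι.app (U ⊓ V) g)) y = n

/-- The degree of `ι^* L` on `Y` is `n`, where `Y` is a proper integral curve over an
algebraically closed field: the divisor of any nonzero rational section has degree `n`.
(Every nonzero rational section of `ι^* L` is the restriction of a section `s` of `L` over some open
set containing the generic point `η` of `Y`, with `s` not vanishing at `η`.) -/
def HasDegree (n : ℤ) : Prop :=
  ∀ (U : X.Opens) (hU : ι (genericPoint Y) ∈ U) (s : Γ(L, U)),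
    ¬ VanishesAt L s (ι (genericPoint Y)) hU →
    ∃ D : Y → ℤ, (∀ y, HasOrderAt ι L s y (D y)) ∧ (Function.support D).Finite ∧
      ∑ᶠ y, D y = n

end Degree

/-! ### Chains of three smooth curves -/

/-- A curve `X` of compact type over `k` that is the union of three smooth curves
`X₁, X₂, X₃` (indexed here by `0, 1, 2`), where `X₁` and `X₂` meet transversally at one point `A`,
`X₂` and `X₃` meet transversally at one point `B ≠ A`, and `X₁`, `X₃` do not meet. Transversality
at a point means that the scheme-theoretic intersection is the reduced point. -/
structure ChainCurve (k : Type u) [Field k] where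
  X : Scheme.{u}
  str : X ⟶ Spec (CommRingCat.of k)
  proper : IsProper str
  reduced : IsReduced X
  comp : Fin 3 → Scheme.{u}
  ι : ∀ q, comp q ⟶ X
  closedImmersion : ∀ q, IsClosedImmersion (ι q)
  integral : ∀ q, IsIntegral (comp q)
  smooth : ∀ q, SmoothOfRelativeDimension 1 (ι q ≫ str)
  cover : (⋃ q, Set.range (ι q)) = Set.univ
  A : X
  B : X
  A_ne_B : A ≠ B
  inter_one_two : Set.range (ι 0) ∩ Set.range (ι 1) = {A}
  inter_two_three : Set.range (ι 1) ∩ Set.range (ι 2) = {B}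
  inter_one_three : Set.range (ι 0) ∩ Set.range (ι 2) = ∅
  transversal_one_two : IsReduced (Limits.pullback (ι 0) (ι 1))
  transversal_two_three : IsReduced (Limits.pullback (ι 1) (ι 2))

namespace ChainCurve

variable {k : Type u} [Field k] (C : ChainCurve k)

instance (q : Fin 3) : IsIntegral (C.comp q) := C.integral q

instance (q : Fin 3) : IsLocallyNoetherian (C.comp q) := by
  have := C.smooth q
  have : Smooth (C.ι q ≫ C.str) := SmoothOfRelativeDimension.smooth 1 _
  exact LocallyOfFiniteType.isLocallyNoetherian (C.ι q ≫ C.str)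

/-- The component `X_q` as a subset of `X`. -/
def component (q : Fin 3) : Set C.X := Set.range (C.ι q)

/-- The subset `X_q^c`, the closure of the complement of `X_q`: the union of the
other two components. -/
def coComponent (q : Fin 3) : Set C.X := ⋃ p ∈ ({q}ᶜ : Set (Fin 3)), C.component p

/-- The structure map `k → Γ(X, 𝒪_X)`. -/
def scalars : k →+* Γ(C.X, ⊤) :=
  ((Scheme.ΓSpecIso (CommRingCat.of k)).inv ≫ C.str.appTop).hom

/-- The `k`-vector space `H⁰(X, M)`. -/
def H0 (M : C.X.Modules) : Type u := Γ(M, ⊤)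

instance (M : C.X.Modules) : AddCommGroup (C.H0 M) := inferInstanceAs (AddCommGroup Γ(M, ⊤))

instance (M : C.X.Modules) : Module k (C.H0 M) :=
  Module.compHom Γ(M, ⊤) C.scalars

/-- The map on global sections induced by a map of sheaves. -/
def H0map {M N : C.X.Modules} (φ : M ⟶ N) : C.H0 M →ₗ[k] C.H0 N where
  toFun := fun s => φ.app ⊤ s
  map_add' s t := map_add (φ.app ⊤).hom s t
  map_smul' a s := φ.app_smul (C.scalars a) s

/-- The subspace of global sections that vanish on `Z`. -/
def vanishing (M : C.X.Modules) (Z : Set C.X) : Submodule k (C.H0 M) where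
  carrier := {s | VanishesOn M (U := ⊤) s Z}
  add_mem' {s t} hs ht x hx hZ := by
    have h := Submodule.add_mem _ (hs x hx hZ) (ht x hx hZ)
    have e := map_add ((Scheme.Modules.presheaf M).germ ⊤ x hx).hom s t
    exact (congrArg (fun y => y ∈ (IsLocalRing.maximalIdeal (C.X.presheaf.stalk x) •
      (⊤ : Submodule (C.X.presheaf.stalk x) ((Scheme.Modules.presheaf M).stalk x)))) e).mpr h
  zero_mem' x hx _ := by
    have e := map_zero ((Scheme.Modules.presheaf M).germ ⊤ x hx).hom
    exact (congrArg (fun y => y ∈ (IsLocalRing.maximalIdeal (C.X.presheaf.stalk x) •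
      (⊤ : Submodule (C.X.presheaf.stalk x) ((Scheme.Modules.presheaf M).stalk x)))) e).mpr
        (Submodule.zero_mem _)
  smul_mem' a s hs x hx hZ := by
    have h := Submodule.smul_mem _ (C.X.presheaf.germ ⊤ x hx (C.scalars a)) (hs x hx hZ)
    have e := germ_smul M ⊤ x hx (C.scalars a) s
    exact (congrArg (fun y => y ∈ (IsLocalRing.maximalIdeal (C.X.presheaf.stalk x) •
      (⊤ : Submodule (C.X.presheaf.stalk x) ((Scheme.Modules.presheaf M).stalk x)))) e).mpr h

/-- `V^{Z,0}`: the sections in `V` that vanish on `Z`. -/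
def sub {M : C.X.Modules} (V : Submodule k (C.H0 M)) (Z : Set C.X) : Submodule k (C.H0 M) :=
  V ⊓ C.vanishing M Z

end ChainCurve

/-! ### Multidegrees and paths -/

/-- Nonnegative multidegrees `(i, d - i - l, l)` of total degree `d`. -/
@[ext]
structure Multidegree (d : ℕ) where
  deg : Fin 3 → ℕ
  sum_deg : ∑ q, deg q = d

/-- The multidegree of `𝒪_{(X_q)}`, the twist by the component `X_q`. -/
def twistDeg : Fin 3 → Fin 3 → ℤ := ![![-1, 1, 0], ![1, -2, 1], ![0, 1, -1]]

/-- `m' = m + multideg 𝒪_{(X_q)}`. -/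
def IsTwist {d : ℕ} (q : Fin 3) (m m' : Multidegree d) : Prop :=
  ∀ p, (m'.deg p : ℤ) = m.deg p + twistDeg q p

/-- Paths of nonnegative multidegrees, each one obtained from the preceding one by adding
(`up`) or subtracting (`down`) the multidegree of some `𝒪_{(X_q)}`. -/
inductive LinkPath {d : ℕ} : Multidegree d → Multidegree d → Type
  | nil (a : Multidegree d) : LinkPath a a
  | up {a b c : Multidegree d} (p : LinkPath a b) (q : Fin 3) (h : IsTwist q b c) : LinkPath a c
  | down {a b c : Multidegree d} (p : LinkPath a b) (q : Fin 3) (h : IsTwist q c b) : LinkPath a c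

namespace LinkPath

variable {d : ℕ}

/-- The components that are added along the path. -/
def ups : ∀ {a b : Multidegree d}, LinkPath a b → Finset (Fin 3)
  | _, _, nil _ => ∅
  | _, _, up p q _ => insert q p.ups
  | _, _, down p _ _ => p.ups

/-- The components that are subtracted along the path. -/
def downs : ∀ {a b : Multidegree d}, LinkPath a b → Finset (Fin 3)
  | _, _, nil _ => ∅
  | _, _, up p _ _ => p.downs
  | _, _, down p q _ => insert q p.downs

/-- None of the following holds: all three components are added; some component is both added and
subtracted; two different components are subtracted. -/
def Admissible {a b : Multidegree d} (p : LinkPath a b) : Prop :=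
  p.ups ≠ Finset.univ ∧ Disjoint p.ups p.downs ∧ p.downs.card ≤ 1

lemma isTwist_of {q : Fin 3} {x y : Multidegree d}
    (h0 : (y.deg 0 : ℤ) = x.deg 0 + twistDeg q 0)
    (h2 : (y.deg 2 : ℤ) = x.deg 2 + twistDeg q 2) : IsTwist q x y := by
  have hx := x.sum_deg
  have hy := y.sum_deg
  have ht : twistDeg q 0 + twistDeg q 1 + twistDeg q 2 = 0 := by
    fin_cases q <;> simp [twistDeg]
  simp only [Fin.sum_univ_three] at hx hy
  intro p
  fin_cases p
  · exact h0
  · change (y.deg 1 : ℤ) = x.deg 1 + twistDeg q 1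
    omega
  · exact h2

/-- There is a path from `m` to `b` that only adds components in `S` and subtracts those in `T`. -/
def Within (m : Multidegree d) (S T : Finset (Fin 3)) (b : Multidegree d) : Prop :=
  ∃ p : LinkPath m b, p.ups ⊆ S ∧ p.downs ⊆ T

lemma Within.up {m b c : Multidegree d} {S T : Finset (Fin 3)} (h : Within m S T c) (q : Fin 3)
    (hq : q ∈ S) (h0 : (b.deg 0 : ℤ) = c.deg 0 + twistDeg q 0)
    (h2 : (b.deg 2 : ℤ) = c.deg 2 + twistDeg q 2) : Within m S T b := by
  obtain ⟨p, hu, hd⟩ := h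
  refine ⟨LinkPath.up p q (isTwist_of h0 h2), ?_, ?_⟩
  · rw [ups]
    exact Finset.insert_subset hq hu
  · rw [downs]
    exact hd

lemma Within.down {m b c : Multidegree d} {S T : Finset (Fin 3)} (h : Within m S T c) (q : Fin 3)
    (hq : q ∈ T) (h0 : (c.deg 0 : ℤ) = b.deg 0 + twistDeg q 0)
    (h2 : (c.deg 2 : ℤ) = b.deg 2 + twistDeg q 2) : Within m S T b := by
  obtain ⟨p, hu, hd⟩ := h
  refine ⟨LinkPath.down p q (isTwist_of h0 h2), ?_, ?_⟩
  · rw [ups]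
    exact hu
  · rw [downs]
    exact Finset.insert_subset hq hd

lemma Within.refl {m b : Multidegree d} {S T : Finset (Fin 3)} (h0 : b.deg 0 = m.deg 0)
    (h2 : b.deg 2 = m.deg 2) : Within m S T b := by
  have hm := m.sum_deg
  have hb := b.sum_deg
  simp only [Fin.sum_univ_three] at hm hb
  have : m = b := by
    ext q
    fin_cases q
    · exact h0.symm
    · change m.deg 1 = b.deg 1
      omega
    · exact h2.symm
  subst this
  exact ⟨nil m, by simp [ups], by simp [downs]⟩

lemma Within.admissible {m b : Multidegree d} {u v w : Fin 3} (h : Within m {u, v} {w} b)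
    (hu : w ≠ u) (hv : w ≠ v) : ∃ p : LinkPath m b, p.Admissible := by
  obtain ⟨p, h1, h2⟩ := h
  refine ⟨p, fun h => ?_, ?_, (Finset.card_le_card h2).trans (by simp)⟩
  · have := h1 (h ▸ Finset.mem_univ w)
    simp [hu, hv] at this
  · refine Finset.disjoint_of_subset_left h1 (Finset.disjoint_of_subset_right h2 ?_)
    simp [hu, hv]

/-- Any two multidegrees are connected by an admissible path. -/
theorem exists_admissible (m m' : Multidegree d) : ∃ p : LinkPath m m', p.Admissible := by
  have mk : ∀ x y z : ℕ, x + y + z = d → ∃ c : Multidegree d, c.deg 0 = x ∧ c.deg 2 = z :=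
    fun x y z h => ⟨⟨![x, y, z], by simp [Fin.sum_univ_three, h]⟩, by simp, by simp⟩
  have t0 : twistDeg 0 0 = -1 ∧ twistDeg 0 2 = 0 := by simp [twistDeg]
  have t1 : twistDeg 1 0 = 1 ∧ twistDeg 1 2 = 1 := by simp [twistDeg]
  have t2 : twistDeg 2 0 = 0 ∧ twistDeg 2 2 = -1 := by simp [twistDeg]
  have key : ∀ (n α β : ℕ) (b : Multidegree d), n = α + β →
      ((b.deg 0 : ℤ) = m.deg 0 - α → (b.deg 2 : ℤ) = m.deg 2 - β → Within m {0, 2} {1} b) ∧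
      ((b.deg 0 : ℤ) = m.deg 0 + β - α → (b.deg 2 : ℤ) = m.deg 2 + β →
        Within m {0, 1} {2} b) ∧
      ((b.deg 2 : ℤ) = m.deg 2 + β - α → (b.deg 0 : ℤ) = m.deg 0 + β →
        Within m {1, 2} {0} b) := by
    intro n
    induction n using Nat.strong_induction_on with
    | _ n ih =>
      intro α β b hn
      have hb := b.sum_deg
      have hm := m.sum_deg
      simp only [Fin.sum_univ_three] at hb hm
      by_cases h00 : α = 0 ∧ β = 0
      · exact ⟨fun _ _ => .refl (by omega) (by omega), fun _ _ => .refl (by omega) (by omega),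
          fun _ _ => .refl (by omega) (by omega)⟩
      refine ⟨fun e0 e2 => ?_, fun e0 e2 => ?_, fun e2 e0 => ?_⟩
      · by_cases hα : α = 0
        · obtain ⟨c, c0, c2⟩ := mk (b.deg 0) (b.deg 1 - 1) (b.deg 2 + 1) (by omega)
          exact ((ih (n - 1) (by omega) α (β - 1) c (by omega)).1 (by omega) (by omega)).up 2
            (by simp) (by omega) (by omega)
        · obtain ⟨c, c0, c2⟩ := mk (b.deg 0 + 1) (b.deg 1 - 1) (b.deg 2) (by omega)
          exact ((ih (n - 1) (by omega) (α - 1) β c (by omega)).1 (by omega) (by omega)).up 0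
            (by simp) (by omega) (by omega)
      · by_cases hβ : β = 0
        · obtain ⟨c, c0, c2⟩ := mk (b.deg 0 + 1) (b.deg 1 - 1) (b.deg 2) (by omega)
          exact ((ih (n - 1) (by omega) (α - 1) β c (by omega)).2.1 (by omega) (by omega)).up 0
            (by simp) (by omega) (by omega)
        by_cases hα : α = 0
        · obtain ⟨c, c0, c2⟩ := mk (b.deg 0 - 1) (b.deg 1 + 2) (b.deg 2 - 1) (by omega)
          exact ((ih (n - 1) (by omega) α (β - 1) c (by omega)).2.1 (by omega) (by omega)).up 1
            (by simp) (by omega) (by omega)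
        · obtain ⟨c, c0, c2⟩ := mk (b.deg 0) (b.deg 1 + 1) (b.deg 2 - 1) (by omega)
          exact ((ih (n - 2) (by omega) (α - 1) (β - 1) c (by omega)).2.1 (by omega)
            (by omega)).down 2 (by simp) (by omega) (by omega)
      · by_cases hβ : β = 0
        · obtain ⟨c, c0, c2⟩ := mk (b.deg 0) (b.deg 1 - 1) (b.deg 2 + 1) (by omega)
          exact ((ih (n - 1) (by omega) (α - 1) β c (by omega)).2.2 (by omega) (by omega)).up 2
            (by simp) (by omega) (by omega)
        by_cases hα : α = 0
        · obtain ⟨c, c0, c2⟩ := mk (b.deg 0 - 1) (b.deg 1 + 2) (b.deg 2 - 1) (by omega)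
          exact ((ih (n - 1) (by omega) α (β - 1) c (by omega)).2.2 (by omega) (by omega)).up 1
            (by simp) (by omega) (by omega)
        · obtain ⟨c, c0, c2⟩ := mk (b.deg 0 - 1) (b.deg 1 + 1) (b.deg 2) (by omega)
          exact ((ih (n - 2) (by omega) (α - 1) (β - 1) c (by omega)).2.2 (by omega)
            (by omega)).down 0 (by simp) (by omega) (by omega)
  by_cases h1 : m'.deg 0 ≤ m.deg 0 ∧ m'.deg 2 ≤ m.deg 2
  · exact ((key _ (m.deg 0 - m'.deg 0) (m.deg 2 - m'.deg 2) m' rfl).1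
      (by omega) (by omega)).admissible (by decide) (by decide)
  by_cases h2 : (m'.deg 0 : ℤ) - m.deg 0 ≤ (m'.deg 2 : ℤ) - m.deg 2
  · exact ((key _ (m'.deg 2 - m.deg 2 + m.deg 0 - m'.deg 0) (m'.deg 2 - m.deg 2) m' rfl).2.1
      (by omega) (by omega)).admissible (by decide) (by decide)
  · exact ((key _ (m'.deg 0 - m.deg 0 + m.deg 2 - m'.deg 2) (m'.deg 0 - m.deg 0) m' rfl).2.2
      (by omega) (by omega)).admissible (by decide) (by decide)

end LinkPath

/-! ### Limit linear series -/

/-- Invertible sheaves `ℒ_m` of multidegree `m` on `X`, one for each nonnegative multidegree of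
total degree `d`, with the maps `φ_{m,m'}` (`up`) and `φ_{m',m}` (`down`) for
`m' = m + multideg 𝒪_{(X_q)}`, satisfying
(1) `φ_{m,m'}` factors as `ℒ_m → ℒ_m|_{X_q^c} ≅ ℒ_{m'}|_{X_q^c}(-X_q ∩ X_q^c) ↪ ℒ_{m'}`;
(2) `φ_{m',m}` factors as `ℒ_{m'} → ℒ_{m'}|_{X_q} ≅ ℒ_m|_{X_q}(-X_q ∩ X_q^c) ↪ ℒ_m`;
(3) `φ_{m²,m³} ∘ φ_{m¹,m²} = φ_{m¹,m³}` when `m² = m¹ + multideg 𝒪_{(X_{q₁})}` and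
`m³ = m² + multideg 𝒪_{(X_{q₂})}` with `q₁ ≠ q₂`; then `m¹ = m³ + multideg 𝒪_{(X_{q₃})}` for the
third component. -/
structure LinkedSheaves {k : Type u} [Field k] (C : ChainCurve k) (d : ℕ) where
  L : Multidegree d → C.X.Modules
  invertible : ∀ m, IsInvertible (L m)
  multidegree : ∀ m q, HasDegree (C.ι q) (L m) (m.deg q)
  up : ∀ {m m' : Multidegree d} (q : Fin 3), IsTwist q m m' → (L m ⟶ L m')
  down : ∀ {m m' : Multidegree d} (q : Fin 3), IsTwist q m m' → (L m' ⟶ L m)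
  up_factors : ∀ {m m' : Multidegree d} (q : Fin 3) (h : IsTwist q m m'),
    FactorsThrough (up q h) (C.coComponent q) (C.component q)
  down_factors : ∀ {m m' : Multidegree d} (q : Fin 3) (h : IsTwist q m m'),
    FactorsThrough (down q h) (C.component q) (C.coComponent q)
  up_up : ∀ {m₁ m₂ m₃ : Multidegree d} (q₁ q₂ q₃ : Fin 3), q₁ ≠ q₂ →
    ∀ (h₁₂ : IsTwist q₁ m₁ m₂) (h₂₃ : IsTwist q₂ m₂ m₃) (h₃₁ : IsTwist q₃ m₃ m₁),
      up q₁ h₁₂ ≫ up q₂ h₂₃ = down q₃ h₃₁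

namespace LinkedSheaves

variable {k : Type u} [Field k] {C : ChainCurve k} {d : ℕ} (E : LinkedSheaves C d)

/-- The composite on global sections of the maps along a path. -/
def along : ∀ {a b : Multidegree d}, LinkPath a b → (C.H0 (E.L a) →ₗ[k] C.H0 (E.L b))
  | _, _, .nil _ => LinearMap.id
  | _, _, .up p q h => C.H0map (E.up q h) ∘ₗ along p
  | _, _, .down p q h => C.H0map (E.down q h) ∘ₗ along p

/-- The map `φ_{m,m'} : H⁰(ℒ_m) → H⁰(ℒ_{m'})` for arbitrary `m`, `m'`: the composite along an
admissible path (all admissible paths have the same composite; for `m = m'` the only one is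
the empty path and `φ_{m,m} = id`). -/
def link (m m' : Multidegree d) : C.H0 (E.L m) →ₗ[k] C.H0 (E.L m') :=
  E.along (LinkPath.exists_admissible m m').choose

end LinkedSheaves

/-- A limit linear series of degree `d` and dimension `r` on `X`. -/
structure LimitLinearSeries {k : Type u} [Field k] (C : ChainCurve k) (d r : ℕ) extends
    LinkedSheaves C d where
  V : ∀ m : Multidegree d, Submodule k (C.H0 (L m))
  finrank_eq : ∀ m, Module.finrank k (V m) = r + 1
  map_up_le : ∀ {m m' : Multidegree d} (q : Fin 3) (h : IsTwist q m m'),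
    (V m).map (C.H0map (up q h)) ≤ V m'
  map_down_le : ∀ {m m' : Multidegree d} (q : Fin 3) (h : IsTwist q m m'),
    (V m').map (C.H0map (down q h)) ≤ V m

namespace LimitLinearSeries

variable {k : Type u} [Field k] {C : ChainCurve k} {d r : ℕ} (S : LimitLinearSeries C d r)

/-- `V_m^{X_q,0}`. -/
def van (m : Multidegree d) (q : Fin 3) : Submodule k (C.H0 (S.L m)) :=
  C.sub (S.V m) (C.component q)

/-- `V_m^{X_q^c,0}`. -/
def vanCo (m : Multidegree d) (q : Fin 3) : Submodule k (C.H0 (S.L m)) :=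
  C.sub (S.V m) (C.coComponent q)

/-- Exactness. -/
def IsExact : Prop :=
  ∀ (m m' : Multidegree d) (q : Fin 3) (h : IsTwist q m m'),
    (S.V m).map (C.H0map (S.up q h)) = S.van m' q ∧
    (S.V m').map (C.H0map (S.down q h)) = S.vanCo m q

/-- Distributivity holds in `V_m`. -/
def Distributive (m : Multidegree d) : Prop :=
  S.van m 0 ⊓ (S.van m 1 ⊔ S.van m 2) = S.van m 0 ⊓ S.van m 1 ⊔ S.van m 0 ⊓ S.van m 2

/-- `V_m^{X₁,0} + V_m^{X₂,0} + V_m^{X₃,0}`. -/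
def vanSum (m : Multidegree d) : Submodule k (C.H0 (S.L m)) :=
  S.van m 0 ⊔ S.van m 1 ⊔ S.van m 2

/-- The multidegrees `D α` and the sections `s α z ∈ V_{D α}` form a simple basis: for each `m` the
images `φ_{D α, m} (s α z)` form a basis of `V_m`. -/
structure IsSimpleBasis {n : ℕ} (D : Fin n → Multidegree d) (ρ : Fin n → ℕ)
    (s : ∀ α, Fin (ρ α) → C.H0 (S.L (D α))) : Prop where
  injective : Function.Injective D
  mem : ∀ α z, s α z ∈ S.V (D α)
  independent : ∀ α, LinearIndependent k (s α)
  basis_independent : ∀ m, LinearIndependent k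
    (fun p : (Σ α, Fin (ρ α)) => S.link (D p.1) m (s p.1 p.2))
  basis_span : ∀ m, Submodule.span k
    (Set.range (fun p : (Σ α, Fin (ρ α)) => S.link (D p.1) m (s p.1 p.2))) = S.V m

/-- A limit linear series is simple if it has a simple basis. -/
def IsSimple : Prop :=
  ∃ (n : ℕ) (D : Fin n → Multidegree d) (ρ : Fin n → ℕ)
    (s : ∀ α, Fin (ρ α) → C.H0 (S.L (D α))), S.IsSimpleBasis D ρ s

end LimitLinearSeries

end LLS

end

/-! ### Multidegrees modulo the relation among the three twists. -/

namespace LLS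

variable {d : ℕ}

/-! Write t_q for `twistDeg q`. As t_0 + t_1 + t_2 = 0, any y and m satisfy m = y + ∑ c_q t_q for a
unique c ≥ 0 with minimum 0, namely `coef y m`. For fixed m the sources y fall into seven cells: m
itself, three rays (only c_u nonzero) and three open sectors (only c_w zero). A link from ray u can
be taken to end by adding t_u, so its image lies in `van m u`. A link from open sector w can be
taken to end by subtracting t_w, starting from m + t_w, so its image lies in `vanCo m w`, the
intersection of the two other `van m u`. Exactness describes `van m u` and `vanCo m w` as the full
images of these last steps. Where the required neighbour of m would have a negative degree,
exactness is silent, and counting zeros on a component of small degree takes its place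
(`exists_van_le`, `vanCo_eq_bot`).

Generation (`IsExact.le_linkSpan`) needs only exactness: pulling `van m u` back along its ray
leaves, besides ray contributions, intersections of two `van`, which are `vanCo` and are pulled back
through a sector.

Independence (`IsExact.eq_zero_of_linkSum_eq_zero`) needs distributivity. In a vanishing sum of
links into m, the term at m lies in `vanSum m` and in its complement, so it is zero. Each ray term
then lies in `van m u ⊓ (van m v ⊔ van m w)`; distributivity and exactness transfer the analogous
condition to the preceding point of the ray, and induction kills the ray (`IsExact.eq_zero_of_ray`).
The sector terms that remain vanish on all three components, hence are zero, and a second induction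
goes down each sector (`IsExact.eq_zero_of_sector`). -/

lemma IsTwist.cases {q : Fin 3} {m m' : Multidegree d} (h : IsTwist q m m') :
    (q = 0 ∧ m.deg 0 = m'.deg 0 + 1 ∧ m'.deg 1 = m.deg 1 + 1 ∧ m'.deg 2 = m.deg 2) ∨
    (q = 1 ∧ m'.deg 0 = m.deg 0 + 1 ∧ m.deg 1 = m'.deg 1 + 2 ∧ m'.deg 2 = m.deg 2 + 1) ∨
    (q = 2 ∧ m'.deg 0 = m.deg 0 ∧ m'.deg 1 = m.deg 1 + 1 ∧ m.deg 2 = m'.deg 2 + 1) := by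
  have h0 := h 0
  have h1 := h 1
  have h2 := h 2
  fin_cases q <;> simp [twistDeg] at h0 h1 h2 ⊢ <;> omega

lemma Multidegree.ext_of_eq {m m' : Multidegree d} (h0 : m.deg 0 = m'.deg 0)
    (h1 : m.deg 1 = m'.deg 1) (h2 : m.deg 2 = m'.deg 2) : m = m' := by
  ext q
  fin_cases q <;> assumption

lemma IsTwist.right_unique {q : Fin 3} {m a b : Multidegree d} (h : IsTwist q m a)
    (h' : IsTwist q m b) : a = b := by
  refine Multidegree.ext_of_eq ?_ ?_ ?_ <;>
  · have h1 := h.cases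
    have h2 := h'.cases
    omega

lemma IsTwist.left_unique {q : Fin 3} {m a b : Multidegree d} (h : IsTwist q a m)
    (h' : IsTwist q b m) : a = b := by
  refine Multidegree.ext_of_eq ?_ ?_ ?_ <;>
  · have h1 := h.cases
    have h2 := h'.cases
    omega

instance : Finite (Multidegree d) := by
  refine Finite.of_injective
    (fun m : Multidegree d => fun q => (⟨m.deg q, ?_⟩ : Fin (d + 1))) fun a b h => ?_
  · rw [Nat.lt_succ_iff]
    calc m.deg q ≤ ∑ p, m.deg p := Finset.single_le_sum (by simp) (Finset.mem_univ q)
      _ = d := m.sum_deg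
  · ext q
    simpa using congrFun h q

/-- The multidegree with given degrees on the components. -/
def Multidegree.mk₃ (i j l : ℕ) (h : i + j + l = d) : Multidegree d :=
  ⟨![i, j, l], by simp [Fin.sum_univ_three, h]⟩

lemma Multidegree.sum_eq (m : Multidegree d) : m.deg 0 + m.deg 1 + m.deg 2 = d := by
  simpa [Fin.sum_univ_three] using m.sum_deg

lemma isTwist_zero_mk (m : Multidegree d) (h : 1 ≤ m.deg 0) : ∃ m', IsTwist 0 m m' := by
  have := m.sum_eq
  exact ⟨.mk₃ (m.deg 0 - 1) (m.deg 1 + 1) (m.deg 2) (by omega), LinkPath.isTwist_of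
    (by simp [Multidegree.mk₃, twistDeg]; omega) (by simp [Multidegree.mk₃, twistDeg])⟩

lemma isTwist_one_mk (m : Multidegree d) (h : 2 ≤ m.deg 1) : ∃ m', IsTwist 1 m m' := by
  have := m.sum_eq
  exact ⟨.mk₃ (m.deg 0 + 1) (m.deg 1 - 2) (m.deg 2 + 1) (by omega), LinkPath.isTwist_of
    (by simp [Multidegree.mk₃, twistDeg]) (by simp [Multidegree.mk₃, twistDeg])⟩

lemma isTwist_two_mk (m : Multidegree d) (h : 1 ≤ m.deg 2) : ∃ m', IsTwist 2 m m' := by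
  have := m.sum_eq
  exact ⟨.mk₃ (m.deg 0) (m.deg 1 + 1) (m.deg 2 - 1) (by omega), LinkPath.isTwist_of
    (by simp [Multidegree.mk₃, twistDeg]) (by simp [Multidegree.mk₃, twistDeg]; omega)⟩

lemma mk_isTwist_zero (m : Multidegree d) (h : 1 ≤ m.deg 1) : ∃ m', IsTwist 0 m' m := by
  have := m.sum_eq
  exact ⟨.mk₃ (m.deg 0 + 1) (m.deg 1 - 1) (m.deg 2) (by omega), LinkPath.isTwist_of
    (by simp [Multidegree.mk₃, twistDeg]) (by simp [Multidegree.mk₃, twistDeg])⟩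

lemma mk_isTwist_one (m : Multidegree d) (h : 1 ≤ m.deg 0) (h' : 1 ≤ m.deg 2) :
    ∃ m', IsTwist 1 m' m := by
  have := m.sum_eq
  exact ⟨.mk₃ (m.deg 0 - 1) (m.deg 1 + 2) (m.deg 2 - 1) (by omega), LinkPath.isTwist_of
    (by simp [Multidegree.mk₃, twistDeg]; omega) (by simp [Multidegree.mk₃, twistDeg]; omega)⟩

lemma mk_isTwist_two (m : Multidegree d) (h : 1 ≤ m.deg 1) : ∃ m', IsTwist 2 m' m := by
  have := m.sum_eq
  exact ⟨.mk₃ (m.deg 0) (m.deg 1 - 1) (m.deg 2 + 1) (by omega), LinkPath.isTwist_of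
    (by simp [Multidegree.mk₃, twistDeg]) (by simp [Multidegree.mk₃, twistDeg])⟩

/-- The coefficients `c` with `m = x + ∑ q, c q • twistDeg q` and `min c = 0`. -/
def coef (x m : Multidegree d) : Fin 3 → ℕ :=
  ![max (m.deg 0 - x.deg 0) (m.deg 2 - x.deg 2) + x.deg 0 - m.deg 0,
    max (m.deg 0 - x.deg 0) (m.deg 2 - x.deg 2),
    max (m.deg 0 - x.deg 0) (m.deg 2 - x.deg 2) + x.deg 2 - m.deg 2]

/-- Comparing degrees on the outer components gives c_0 = c_1 + x_0 - m_0 and c_2 = c_1 + x_2 - m_2,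
so c_1 is the least natural number making both nonnegative. The truncated subtractions inside the
maximum supply the bound c_1 ≥ 0. -/
lemma coef_zero (x m : Multidegree d) : coef x m 0 =
    max (m.deg 0 - x.deg 0) (m.deg 2 - x.deg 2) + x.deg 0 - m.deg 0 := rfl

lemma coef_one (x m : Multidegree d) : coef x m 1 =
    max (m.deg 0 - x.deg 0) (m.deg 2 - x.deg 2) := rfl

lemma coef_two (x m : Multidegree d) : coef x m 2 =
    max (m.deg 0 - x.deg 0) (m.deg 2 - x.deg 2) + x.deg 2 - m.deg 2 := rfl

lemma coef_self (m : Multidegree d) (q : Fin 3) : coef m m q = 0 := by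
  fin_cases q <;> simp [coef]

lemma exists_coef_eq_zero (x m : Multidegree d) : ∃ w, coef x m w = 0 := by
  have h0 := coef_zero x m
  have h1 := coef_one x m
  have h2 := coef_two x m
  by_contra! h
  have := h 0
  have := h 1
  have := h 2
  omega

lemma eq_of_coef_eq_zero {x m : Multidegree d} (h : ∀ q, coef x m q = 0) : x = m := by
  have h0 := coef_zero x m
  have h1 := coef_one x m
  have h2 := coef_two x m
  have := h 0
  have := h 1
  have := h 2
  have := x.sum_eq
  have := m.sum_eq
  refine Multidegree.ext_of_eq ?_ ?_ ?_ <;> omega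

/-- Adding a twist different from `w` inside the sector of `w`. -/
lemma coef_up {x a m : Multidegree d} {q w : Fin 3} (h : IsTwist q a m) (hw : coef x a w = 0)
    (hq : q ≠ w) : coef x m w = 0 ∧ ∀ p, coef x m p = coef x a p + if p = q then 1 else 0 := by
  have h0 := coef_zero x m
  have h1 := coef_one x m
  have h2 := coef_two x m
  have k0 := coef_zero x a
  have k1 := coef_one x a
  have k2 := coef_two x a
  have hc := h.cases
  rw [Fin.forall_fin_succ, Fin.forall_fin_two]
  fin_cases w <;> fin_cases q <;> simp at hc hq hw ⊢ <;> omega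

/-- Subtracting the twist `w` inside the sector of `w`. -/
lemma coef_down {x a m : Multidegree d} {w : Fin 3} (h : IsTwist w m a) (hw : coef x a w = 0) :
    coef x m w = 0 ∧ ∀ p, coef x m p = coef x a p + if p = w then 0 else 1 := by
  have h0 := coef_zero x m
  have h1 := coef_one x m
  have h2 := coef_two x m
  have k0 := coef_zero x a
  have k1 := coef_one x a
  have k2 := coef_two x a
  have hc := h.cases
  rw [Fin.forall_fin_succ, Fin.forall_fin_two]
  fin_cases w <;> simp at hc hw ⊢ <;> omega

/-- Together with `coef_up` this shows that a step along a ray matches the sources at `a` with those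
at `m` exactly, which an equality of sums of links requires. `coef_of_down` plays the same role for
sectors. -/
lemma coef_of_up {x a m : Multidegree d} {q w : Fin 3} (h : IsTwist q a m) (hw : coef x m w = 0)
    (hq : coef x m q ≠ 0) : coef x a w = 0 := by
  have h0 := coef_zero x m
  have h1 := coef_one x m
  have h2 := coef_two x m
  have k0 := coef_zero x a
  have k1 := coef_one x a
  have k2 := coef_two x a
  have hc := h.cases
  fin_cases w <;> fin_cases q <;> simp at hc hq hw ⊢ <;> omega

lemma coef_of_down {x a m : Multidegree d} {w : Fin 3} (h : IsTwist w m a)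
    (hw : coef x m w = 0) (hq : ∀ q, q ≠ w → coef x m q ≠ 0) : coef x a w = 0 := by
  have h0 := coef_zero x m
  have h1 := coef_one x m
  have h2 := coef_two x m
  have k0 := coef_zero x a
  have k1 := coef_one x a
  have k2 := coef_two x a
  have hc := h.cases
  rw [Fin.forall_fin_succ, Fin.forall_fin_two] at hq
  fin_cases w <;> simp at hc hq hw ⊢ <;> omega

/-- If only c_q is nonzero, every degree that t_q raises is at least as large at `m` as the amount
t_q adds, because the degrees of `x` are nonnegative. Subtracting t_q from `m` is therefore allowed.
-/
lemma exists_isTwist_of_ray {x m : Multidegree d} {q : Fin 3} (hq : coef x m q ≠ 0)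
    (h : ∀ p, p ≠ q → coef x m p = 0) : ∃ a, IsTwist q a m := by
  have h0 := coef_zero x m
  have h1 := coef_one x m
  have h2 := coef_two x m
  have := x.sum_eq
  have := m.sum_eq
  rw [Fin.forall_fin_succ, Fin.forall_fin_two] at h
  fin_cases q <;> simp at h hq ⊢
  · exact mk_isTwist_zero m (by omega)
  · exact mk_isTwist_one m (by omega) (by omega)
  · exact mk_isTwist_two m (by omega)

/-- Inside an open sector, subtracting just one of the other two twists from `m` may produce a
negative degree. Subtracting both, which is adding t_w, does not: only the degree on component w
drops, and the positive coefficients make it large enough. -/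
lemma exists_isTwist_of_sector {x m : Multidegree d} {w : Fin 3} (hw : coef x m w = 0)
    (h : ∀ p, p ≠ w → coef x m p ≠ 0) : ∃ a, IsTwist w m a := by
  have h0 := coef_zero x m
  have h1 := coef_one x m
  have h2 := coef_two x m
  have := x.sum_eq
  have := m.sum_eq
  rw [Fin.forall_fin_succ, Fin.forall_fin_two] at h
  fin_cases w <;> simp at h hw ⊢
  · exact isTwist_zero_mk m (by omega)
  · exact isTwist_one_mk m (by omega)
  · exact isTwist_two_mk m (by omega)

lemma IsTwist.of_sum {a b c : Multidegree d} {u v w : Fin 3} (huv : u ≠ v) (hu : u ≠ w)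
    (hv : v ≠ w) (h : IsTwist u a b) (h' : IsTwist w b c) : IsTwist v c a := by
  intro p
  have h1 := h p
  have h2 := h' p
  have key : ∀ u v w : Fin 3, u ≠ v → u ≠ w → v ≠ w → ∀ p,
      twistDeg u p + twistDeg v p + twistDeg w p = 0 := by decide
  have := key u v w huv hu hv p
  omega

/-- The decrease of degrees along a ray. -/
lemma exists_deg_lt (u : Fin 3) : ∃ n : Fin 3, ∀ (a m : Multidegree d),
    IsTwist u a m → a.deg n < m.deg n := by
  fin_cases u
  · exact ⟨1, fun a m h => by have := h.cases; simp at this; omega⟩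
  · exact ⟨0, fun a m h => by have := h.cases; simp at this; omega⟩
  · exact ⟨1, fun a m h => by have := h.cases; simp at this; omega⟩

lemma IsTwist.deg_lt {w : Fin 3} {m b : Multidegree d} (h : IsTwist w m b) :
    b.deg w < m.deg w := by
  have := h.cases
  fin_cases w <;> simp at this ⊢ <;> omega

lemma exists_ne_ne (u : Fin 3) : ∃ v w : Fin 3, u ≠ v ∧ u ≠ w ∧ v ≠ w := by
  revert u
  decide

lemma eq_or_eq_or_eq {u v w : Fin 3} (huv : u ≠ v) (hu : u ≠ w) (hv : v ≠ w)
    (q : Fin 3) : q = u ∨ q = v ∨ q = w := by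
  revert u v w q
  decide

/-! ### Admissible paths and the independence of link maps from the path. -/

namespace LinkPath

/-- The path only adds components different from `w` and only subtracts `w`. -/
def Avoids {a b : Multidegree d} (p : LinkPath a b) (w : Fin 3) : Prop :=
  w ∉ p.ups ∧ p.downs ⊆ {w}

lemma avoids_nil (a : Multidegree d) (w : Fin 3) : (nil a).Avoids w := by
  simp [Avoids, ups, downs]

lemma avoids_up {a b c : Multidegree d} {p : LinkPath a b} {q w : Fin 3} {h : IsTwist q b c} :
    (up p q h).Avoids w ↔ p.Avoids w ∧ q ≠ w := by
  simp only [Avoids, ups, downs, Finset.mem_insert, not_or]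
  tauto

lemma avoids_down {a b c : Multidegree d} {p : LinkPath a b} {q w : Fin 3} {h : IsTwist q c b} :
    (down p q h).Avoids w ↔ p.Avoids w ∧ q = w := by
  simp only [Avoids, ups, downs, Finset.insert_subset_iff, Finset.mem_singleton]
  tauto

lemma Admissible.exists_avoids {a b : Multidegree d} {p : LinkPath a b} (h : p.Admissible) :
    ∃ w, p.Avoids w := by
  obtain ⟨h1, h2, h3⟩ := h
  rcases p.downs.eq_empty_or_nonempty with hD | ⟨w, hw⟩
  · obtain ⟨w, hw⟩ : ∃ w, w ∉ p.ups := by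
      by_contra! hU
      exact h1 (Finset.eq_univ_iff_forall.2 hU)
    exact ⟨w, hw, by simp [hD]⟩
  · exact ⟨w, fun hU => Finset.disjoint_left.1 h2 hU hw,
      fun v hv => Finset.mem_singleton.2 (Finset.card_le_one.1 h3 v hv w hw)⟩

/-- Coefficients never decrease along such a path: adding t_q raises c_q by one, and subtracting t_w
raises the two coefficients other than c_w by one. -/
lemma Avoids.coef {a b : Multidegree d} {p : LinkPath a b} {w : Fin 3} (h : p.Avoids w) :
    coef a b w = 0 ∧ (∀ q ∈ p.ups, LLS.coef a b q ≠ 0) ∧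
      (∀ q ∈ p.downs, ∀ r, r ≠ w → LLS.coef a b r ≠ 0) := by
  induction p with
  | nil => simp [ups, downs, coef_self]
  | up p q hq ih =>
    rw [avoids_up] at h
    obtain ⟨h1, h2, h3⟩ := ih h.1
    obtain ⟨k1, k2⟩ := coef_up hq h1 h.2
    refine ⟨k1, fun r hr => ?_, fun r hr s hs => ?_⟩
    · rw [k2]
      rw [ups, Finset.mem_insert] at hr
      rcases hr with rfl | hr
      · simp
      · have := h2 r hr
        omega
    · rw [k2]
      rw [downs] at hr
      have := h3 r hr s hs
      omega
  | down p q hq ih =>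
    rw [avoids_down] at h
    obtain ⟨h, rfl⟩ := h
    obtain ⟨h1, h2, h3⟩ := ih h
    obtain ⟨k1, k2⟩ := coef_down hq h1
    refine ⟨k1, fun r hr => ?_, fun r hr s hs => ?_⟩
    · rw [k2]
      rw [ups] at hr
      have := h2 r hr
      omega
    · rw [k2, if_neg hs]
      omega

/-- The path avoids some v. If v ≠ w and c_w = 0 as well, monotonicity of the coefficients rules out
both an addition of t_w and any subtraction, so w is avoided too. -/
lemma Admissible.avoids {a b : Multidegree d} {p : LinkPath a b} (h : p.Admissible) {w : Fin 3}
    (hw : LLS.coef a b w = 0) : p.Avoids w := by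
  obtain ⟨v, hv⟩ := h.exists_avoids
  by_cases hvw : v = w
  · exact hvw ▸ hv
  obtain ⟨-, h2, h3⟩ := hv.coef
  refine ⟨fun h => h2 w h hw, fun q hq => ?_⟩
  exact absurd hw (h3 q hq w (Ne.symm hvw))

end LinkPath

namespace LinkedSheaves

variable {k : Type u} [Field k] {C : ChainCurve k} (E : LinkedSheaves C d)

open LinkPath

lemma H0map_comp {M N K : C.X.Modules} (φ : M ⟶ N) (ψ : N ⟶ K) :
    C.H0map (φ ≫ ψ) = C.H0map ψ ∘ₗ C.H0map φ := rfl

lemma H0map_up_up {a b c : Multidegree d} {u v w : Fin 3} (huv : u ≠ v) (h : IsTwist u a b)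
    (h' : IsTwist v b c) (h'' : IsTwist w c a) :
    C.H0map (E.up v h') ∘ₗ C.H0map (E.up u h) = C.H0map (E.down w h'') := by
  rw [← E.up_up u v w huv h h' h'', H0map_comp]

lemma exists_avoids {x m : Multidegree d} {w : Fin 3} (h : coef x m w = 0) :
    ∃ p : LinkPath x m, p.Avoids w := by
  obtain ⟨p, hp⟩ := exists_admissible x m
  exact ⟨p, hp.avoids h⟩

/-- Paths that avoid the same component induce the same map. -/
lemma along_eq_of_avoids (n : ℕ) : ∀ (w : Fin 3) (x m : Multidegree d), ∑ q, coef x m q = n →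
    ∀ p p' : LinkPath x m, p.Avoids w → p'.Avoids w → E.along p = E.along p' := by
  induction n using Nat.strong_induction_on with
  | _ n ih =>
  intro w x m hn p p' hp hp'
  have hw := hp.coef.1
  have ih_up : ∀ {a : Multidegree d} {q : Fin 3}, IsTwist q a m → q ≠ w → coef x a w = 0 →
      ∀ r r' : LinkPath x a, r.Avoids w → r'.Avoids w → E.along r = E.along r' := by
    intro a q h hq ha
    refine ih _ ?_ w x a rfl
    have := (coef_up h ha hq).2
    rw [← hn, Finset.sum_congr rfl fun p _ => this p, Finset.sum_add_distrib]
    simp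
  -- In an open sector every path is compared with one whose last step subtracts t_w. On a ray, or
  -- at `x` itself, the last step is forced.
  by_cases hs : ∀ q, q ≠ w → coef x m q ≠ 0
  · obtain ⟨a, ha⟩ := exists_isTwist_of_sector hw hs
    have haw := coef_of_down ha hw hs
    obtain ⟨r, hr⟩ := exists_avoids haw
    have key : ∀ p : LinkPath x m, p.Avoids w → E.along p = E.along (.down r w ha) := by
      intro p hp
      cases p with
      | nil => exact absurd (coef_self x (w + 1)) (hs (w + 1) (by simp))
      | @up b _ p q h =>
        rw [avoids_up] at hp
        obtain ⟨v, hvq, hvw⟩ : ∃ v : Fin 3, v ≠ q ∧ v ≠ w := by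
          have : ∀ q w : Fin 3, ∃ v, v ≠ q ∧ v ≠ w := by decide
          exact this q w
        -- With v the third index, b = a + t_v. By induction the path to `b` may be replaced by one
        -- through `a`, and adding t_v and then t_q composes to subtracting t_w.
        have hv : IsTwist v a b := h.of_sum hvq.symm hp.2 hvw ha
        have := ih_up h hp.2 hp.1.coef.1 p (.up r v hv) hp.1 (avoids_up.2 ⟨hr, hvw⟩)
        rw [along, along, this, along, ← LinearMap.comp_assoc, E.H0map_up_up hvq hv h ha]
      | down p q h =>
        rw [avoids_down] at hp
        obtain ⟨hp, rfl⟩ := hp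
        obtain rfl := ha.right_unique h
        rw [along, along]
        congr 1
        refine ih _ ?_ q x a rfl p r hp hr
        have := (coef_down ha haw).2
        rw [← hn, Finset.sum_congr rfl fun p _ => this p, Finset.sum_add_distrib]
        rw [Nat.lt_add_right_iff_pos]
        exact Finset.sum_pos' (by simp) ⟨q + 1, by simp⟩
    rw [key p hp, key p' hp']
  · push Not at hs
    obtain ⟨v, hvw, hv⟩ := hs
    -- As c_v = c_w = 0, at most one coefficient is nonzero, and only that twist can have been
    -- added.
    have hup : ∀ {b : Multidegree d} {p : LinkPath x b} {q : Fin 3} {h : IsTwist q b m},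
        (LinkPath.up p q h).Avoids w → ∀ q', q' ≠ w → coef x m q' ≠ 0 → q = q' := by
      intro b p q h hp q' hq' hc
      have h1 := hp.coef.2.1 q (by simp [ups])
      have h2 := (avoids_up.1 hp).2
      have : ∀ q q' v w : Fin 3, v ≠ w → q ≠ w → q' ≠ w → q ≠ v → q' ≠ v → q = q' := by decide
      exact this q q' v w hvw h2 hq' (by rintro rfl; exact h1 hv) (by rintro rfl; exact hc hv)
    have hdown : ∀ {b : Multidegree d} {p : LinkPath x b} {q : Fin 3} {h : IsTwist q m b},
        ¬ (LinkPath.down p q h).Avoids w := by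
      intro b p q h hp
      exact hp.coef.2.2 q (by simp [downs]) v hvw hv
    cases p with
    | nil =>
      cases p' with
      | nil => rfl
      | up p' q h => exact absurd (coef_self x q) (hp'.coef.2.1 q (by simp [ups]))
      | down p' q h => exact absurd hp' hdown
    | up p q h =>
      cases p' with
      | nil => exact absurd (coef_self x q) (hp.coef.2.1 q (by simp [ups]))
      | up p' q' h' =>
        obtain rfl := hup hp q' (avoids_up.1 hp').2 (hp'.coef.2.1 q' (by simp [ups]))
        obtain rfl := h.left_unique h'
        rw [avoids_up] at hp hp'
        rw [along, along, ih_up h hp.2 hp.1.coef.1 p p' hp.1 hp'.1]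
      | down p' q h => exact absurd hp' hdown
    | down p q h => exact absurd hp hdown

lemma link_eq_along {x m : Multidegree d} {w : Fin 3} (p : LinkPath x m) (hp : p.Avoids w) :
    E.link x m = E.along p :=
  E.along_eq_of_avoids _ w x m rfl _ p
    ((LinkPath.exists_admissible x m).choose_spec.avoids hp.coef.1) hp

lemma link_self (m : Multidegree d) : E.link m m = LinearMap.id :=
  (E.link_eq_along (.nil m) (avoids_nil m 0)).trans (by rw [along])

lemma link_up {x a m : Multidegree d} {q w : Fin 3} (h : IsTwist q a m) (hw : coef x a w = 0)
    (hq : q ≠ w) : E.link x m = C.H0map (E.up q h) ∘ₗ E.link x a := by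
  obtain ⟨p, hp⟩ := exists_avoids hw
  rw [E.link_eq_along (.up p q h) (avoids_up.2 ⟨hp, hq⟩), E.link_eq_along p hp, along]

lemma link_down {x a m : Multidegree d} {w : Fin 3} (h : IsTwist w m a) (hw : coef x a w = 0) :
    E.link x m = C.H0map (E.down w h) ∘ₗ E.link x a := by
  obtain ⟨p, hp⟩ := exists_avoids hw
  rw [E.link_eq_along (.down p w h) (avoids_down.2 ⟨hp, rfl⟩), E.link_eq_along p hp, along]

end LinkedSheaves

end LLS

/-! ### Vanishing of sections of invertible sheaves. -/

namespace LLS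

section Sections

variable {X : Scheme.{u}} {M N : X.Modules}

lemma germ_res_eq {U V : X.Opens} (h : V ≤ U) (x : X) (hx : x ∈ V) (s : Γ(M, U)) :
    (Scheme.Modules.presheaf M).germ V x hx (res M h s) =
      (Scheme.Modules.presheaf M).germ U x (h hx) s :=
  TopCat.Presheaf.germ_res_apply _ (homOfLE h) x hx s

lemma res_res {U V W : X.Opens} (h : V ≤ U) (h' : W ≤ V) (s : Γ(M, U)) :
    res M h' (res M h s) = res M (h'.trans h) s := by
  simp only [res, ← ConcreteCategory.comp_apply, ← Functor.map_comp]
  rfl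

lemma app_res (φ : M ⟶ N) {U V : X.Opens} (h : V ≤ U) (s : Γ(M, U)) :
    φ.app V (res M h s) = res N h (φ.app U s) :=
  congr($(φ.mapPresheaf.naturality (homOfLE h).op) s)

lemma germ_zero (U : X.Opens) (x : X) (hx : x ∈ U) :
    (Scheme.Modules.presheaf M).germ U x hx (0 : Γ(M, U)) = 0 :=
  map_zero ((Scheme.Modules.presheaf M).germ U x hx).hom

lemma vanishesAt_res_iff {U V : X.Opens} (h : V ≤ U) (s : Γ(M, U)) (x : X) (hx : x ∈ V) :
    VanishesAt M (res M h s) x hx ↔ VanishesAt M s x (h hx) := by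
  rw [VanishesAt, germ_res_eq, VanishesAt]

lemma IsGenerator.restrict {V W : X.Opens} {e : Γ(M, V)} (he : IsGenerator M e) (h : W ≤ V) :
    IsGenerator M (res M h e) := by
  intro W' h'
  simpa only [res_res] using he W' (h'.trans h)

lemma vanishesAt_smul {W : X.Opens} (e : Γ(M, W)) {g : Γ(X, W)} {x : X} (hx : x ∈ W)
    (hg : x ∉ X.basicOpen g) : VanishesAt M (g • e) x hx := by
  rw [VanishesAt, germ_smul]
  rw [X.mem_basicOpen g x hx] at hg
  exact Submodule.smul_mem_smul ((IsLocalRing.mem_maximalIdeal _).2 hg) trivial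

/-- This is Nakayama's argument for a cyclic stalk: the germ of `e` spans, so vanishing gives e = a
e with `a` in the maximal ideal. Since 1 - a is a unit, the germ is zero, and then 1 = 0 on a
smaller neighbourhood by freeness. -/
lemma IsGenerator.not_vanishesAt {W : X.Opens} {e : Γ(M, W)} (he : IsGenerator M e) {x : X}
    (hx : x ∈ W) : ¬ VanishesAt M e x hx := by
  intro h
  have hspan : (⊤ : Submodule (X.presheaf.stalk x) ((Scheme.Modules.presheaf M).stalk x)) ≤
      Submodule.span _ {(Scheme.Modules.presheaf M).germ W x hx e} := by
    intro t _
    obtain ⟨U, hU, hxU, s, rfl⟩ := (Scheme.Modules.presheaf M).exists_le_germ_eq t hx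
    obtain ⟨a, ha⟩ := (he U hU).2 s
    rw [Submodule.mem_span_singleton]
    refine ⟨X.presheaf.germ U x hxU a, ?_⟩
    rw [← ha, germ_smul, germ_res_eq]
  obtain ⟨a, ha, hae⟩ := Submodule.mem_smul_span_singleton.1 (Submodule.smul_mono le_rfl hspan h)
  have hunit : IsUnit (1 - a) := (IsLocalRing.isUnit_or_isUnit_one_sub_self a).resolve_left
    ((IsLocalRing.mem_maximalIdeal _).1 ha)
  have h0 : (Scheme.Modules.presheaf M).germ W x hx e = 0 := by
    rw [← hunit.smul_eq_zero, sub_smul, one_smul, hae, sub_self]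
  rw [← germ_zero W x hx] at h0
  obtain ⟨U, hxU, i, j, hij⟩ := (Scheme.Modules.presheaf M).germ_eq x hx hx e 0 h0
  have h1 : res M i.le e = 0 := hij.trans (map_zero _)
  have h2 : (1 : Γ(X, U)) = 0 := (he U i.le).1 (by simp [h1])
  have h3 := congrArg (X.presheaf.germ U x hxU) h2
  rw [map_one, map_zero] at h3
  exact one_ne_zero h3

lemma IsGenerator.vanishesAt_smul_iff {W : X.Opens} {e : Γ(M, W)} (he : IsGenerator M e)
    {g : Γ(X, W)} {x : X} (hx : x ∈ W) : VanishesAt M (g • e) x hx ↔ x ∉ X.basicOpen g := by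
  refine ⟨fun h hg => he.not_vanishesAt hx ?_, vanishesAt_smul e hx⟩
  rw [X.mem_basicOpen g x hx] at hg
  rw [VanishesAt, germ_smul] at h
  obtain ⟨b, hb⟩ := hg.exists_left_inv
  have := Submodule.smul_mem _ b h
  rwa [smul_smul, hb, one_smul] at this

/-- Locally a section of an invertible sheaf is a multiple of a generator. -/
lemma IsInvertible.exists_eq_smul (hM : IsInvertible M) {U : X.Opens} (s : Γ(M, U)) {x : X}
    (hx : x ∈ U) : ∃ (W : X.Opens) (h : W ≤ U) (_ : x ∈ W) (e : Γ(M, W)) (g : Γ(X, W)),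
      IsGenerator M e ∧ res M h s = g • e := by
  obtain ⟨V, hV, e, he⟩ := hM x
  obtain ⟨g, hg⟩ := (he (U ⊓ V) inf_le_right).2 (res M inf_le_left s)
  exact ⟨U ⊓ V, inf_le_left, ⟨hx, hV⟩, res M inf_le_right e, g, he.restrict _, hg.symm⟩

/-- The vanishing locus of a section of an invertible sheaf is stable under specialization. -/
lemma IsInvertible.vanishesAt_of_specializes (hM : IsInvertible M) {U : X.Opens} {s : Γ(M, U)}
    {x y : X} (hxy : x ⤳ y) {hx : x ∈ U} (hy : y ∈ U) (h : VanishesAt M s x hx) :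
    VanishesAt M s y hy := by
  obtain ⟨W, hWU, hyW, e, g, he, hg⟩ := hM.exists_eq_smul s hy
  have hxW : x ∈ W := hxy.mem_open W.2 hyW
  rw [← vanishesAt_res_iff hWU _ _ hyW, hg, he.vanishesAt_smul_iff]
  rw [← vanishesAt_res_iff hWU _ _ hxW, hg, he.vanishesAt_smul_iff] at h
  exact fun hyg => h (hxy.mem_open (X.basicOpen g).2 hyg)

/-- Morphisms preserve the vanishing of sections of invertible sheaves. -/
lemma IsInvertible.vanishesAt_app (hM : IsInvertible M) (φ : M ⟶ N) {U : X.Opens} {s : Γ(M, U)}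
    {x : X} {hx : x ∈ U} (h : VanishesAt M s x hx) : VanishesAt N (φ.app U s) x hx := by
  obtain ⟨W, hWU, hxW, e, g, he, hg⟩ := hM.exists_eq_smul s hx
  rw [← vanishesAt_res_iff hWU _ _ hxW, hg, he.vanishesAt_smul_iff] at h
  rw [← vanishesAt_res_iff hWU _ _ hxW, ← app_res, hg, Scheme.Modules.Hom.app_smul]
  exact vanishesAt_smul _ hxW h

/-- A section of an invertible sheaf on a reduced scheme that vanishes everywhere is zero. -/
lemma IsInvertible.eq_zero_of_vanishesAt [IsReduced X] (hM : IsInvertible M) {U : X.Opens}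
    {s : Γ(M, U)} (h : ∀ x hx, VanishesAt M s x hx) : s = 0 := by
  refine TopCat.Presheaf.section_ext ⟨M.presheaf, M.isSheaf⟩ U s 0 fun x hx => ?_
  obtain ⟨W, hWU, hxW, e, g, he, hg⟩ := hM.exists_eq_smul s hx
  -- On a reduced scheme a function that is a unit at no point is zero.
  have hg0 : g = 0 := by
    rw [← basicOpen_eq_bot_iff, eq_bot_iff]
    intro y hy
    have hyW := X.basicOpen_le g hy
    have := h y (hWU hyW)
    rw [← vanishesAt_res_iff hWU _ _ hyW, hg, he.vanishesAt_smul_iff] at this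
    exact this hy
  rw [hg0, zero_smul] at hg
  change (Scheme.Modules.presheaf M).germ U x hx s = (Scheme.Modules.presheaf M).germ U x hx 0
  rw [germ_zero, ← germ_res_eq hWU x hxW, hg, germ_zero]

end Sections
end LLS

/-! ### Smooth curves have dimension one; zeros are bounded by the degree. -/

namespace LLS

section Dimension

/-- Étale maps are quasi-finite, so distinct comparable primes have distinct contractions. Chains of
primes thus map to strict chains in a polynomial ring of dimension one. -/
lemma krullDimLE_one_of_etale {K S : Type*} [Field K] [CommRing S]
    (g : MvPolynomial (Fin 1) K →+* S) (hg : g.Etale) : ringKrullDim S ≤ 1 := by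
  algebraize [g]
  have hdim : ringKrullDim (MvPolynomial (Fin 1) K) = 1 := by
    rw [MvPolynomial.ringKrullDim_of_isNoetherianRing, ringKrullDim_eq_zero_of_field]
    simp
  rw [← hdim]
  refine Order.krullDim_le_of_strictMono (PrimeSpectrum.comap g) fun p q hpq => ?_
  refine lt_of_le_of_ne (Ideal.comap_mono hpq.le) fun h => hpq.ne ?_
  exact PrimeSpectrum.ext (Algebra.QuasiFinite.eq_of_le_of_under_eq
    (R := MvPolynomial (Fin 1) K) _ _ hpq.le (congrArg PrimeSpectrum.asIdeal h))

lemma isField_Γ_Spec {k : Type u} [Field k] {U : (Spec (CommRingCat.of k)).Opens}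
    (hU : (U : Set (Spec (CommRingCat.of k))).Nonempty) : IsField Γ(Spec (CommRingCat.of k), U) := by
  have : Subsingleton (Spec (CommRingCat.of k)) :=
    inferInstanceAs (Subsingleton (PrimeSpectrum k))
  obtain rfl : U = ⊤ := by
    obtain ⟨x, hx⟩ := hU
    ext y
    simpa [Subsingleton.elim y x] using hx
  exact (Scheme.ΓSpecIso (CommRingCat.of k)).commRingCatIsoToRingEquiv.toMulEquiv.isField
    (Field.toIsField k)

/-- The points of a smooth curve have codimension at most one. -/
lemma coheight_le_one_of_smooth {k : Type u} [Field k] {Y : Scheme.{u}}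
    (f : Y ⟶ Spec (CommRingCat.of k)) [SmoothOfRelativeDimension 1 f] (y : Y) :
    Order.coheight y ≤ 1 := by
  obtain ⟨U, hU, V, hV, hy, e, hf⟩ :=
    SmoothOfRelativeDimension.exists_isStandardSmoothOfRelativeDimension (n := 1) (f := f) y
  obtain ⟨g, -, hg⟩ := hf.exists_etale_mvPolynomial
  -- The base of the local étale chart is the ring of a nonempty open subset of a one-point
  -- spectrum, hence a field.
  let := (isField_Γ_Spec ⟨f y, e hy⟩ : IsField Γ(Spec (CommRingCat.of k), U)).toField
  have h1 := krullDimLE_one_of_etale g hg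
  let := TopCat.Presheaf.algebra_section_stalk Y.presheaf (⟨y, hy⟩ : V)
  have := hV.isLocalization_stalk ⟨y, hy⟩
  have h2 := ringKrullDim_stalk_eq_coheight y
  rw [IsLocalization.AtPrime.ringKrullDim_eq_height (hV.primeIdealOf ⟨y, hy⟩).asIdeal
    (Y.presheaf.stalk y)] at h2
  have h3 := (Ideal.height_le_ringKrullDim_of_ne_top
    (hV.primeIdealOf ⟨y, hy⟩).isPrime.ne_top).trans h1
  rw [h2] at h3
  exact_mod_cast h3

end Dimension

section Order

variable {Y : Scheme.{u}} [IsIntegral Y] [IsLocallyNoetherian Y]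

lemma ord_germ_nonneg {U : Y.Opens} (hη : genericPoint Y ∈ U) {y : Y} (hy : y ∈ U) {f : Γ(Y, U)}
    (hf : f ≠ 0) : 0 ≤ Scheme.ord (Y.presheaf.germ U (genericPoint Y) hη f) y := by
  have : Nonempty U := ⟨⟨y, hy⟩⟩
  have h := Scheme.ord_le_smul hy hf (1 : Y.functionField)
  have h1 : Scheme.ord (1 : Y.functionField) y = 0 := by
    simpa using Scheme.ord_of_isUnit (f := (1 : Γ(Y, U))) isUnit_one hy
  rw [h1, Algebra.smul_def, mul_one] at h
  exact h

/-- The order is the length of the local ring modulo `f`, and this length is nonzero because `f` is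
not a unit there. -/
lemma one_le_ord_germ {U : Y.Opens} (hη : genericPoint Y ∈ U) {y : Y} (hy : y ∈ U)
    (hc : Order.coheight y = 1) {f : Γ(Y, U)} (hf : f ≠ 0) (hyf : y ∉ Y.basicOpen f) :
    1 ≤ Scheme.ord (Y.presheaf.germ U (genericPoint Y) hη f) y := by
  have : Nonempty U := ⟨⟨y, hy⟩⟩
  have : Ring.KrullDimLE 1 (Y.presheaf.stalk y) := krullDimLE_of_coheight_le hc.le
  have hf' : Y.presheaf.germ U y hy f ≠ 0 := by
    rw [Ne, map_eq_zero_iff _ (germ_injective_of_isIntegral Y y hy)]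
    exact hf
  have hg' : Y.presheaf.germ U (genericPoint Y) hη f ≠ 0 := by
    rw [Ne, map_eq_zero_iff _ (germ_injective_of_isIntegral Y _ hη)]
    exact hf
  rw [Y.mem_basicOpen f y hy] at hyf
  rw [Scheme.le_ord_iff hc hg']
  change _ ≤ Scheme.ordHom y hc (Y.germToFunctionField U f)
  rw [← Scheme.algebraMap_germ_eq_germToFunctionField _ hy, Scheme.ordHom, Ring.ordFrac_eq_ord _ hf']
  have hnz := mem_nonZeroDivisors_of_ne_zero hf'
  obtain ⟨n, hn⟩ := ENat.ne_top_iff_exists.1 (Ring.ord_ne_top hnz)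
  rw [Ring.ordMonoidWithZeroHom_eq_coe _ hnz hn.symm]
  have : n ≠ 0 := by
    rintro rfl
    rw [Ring.ord, Nat.cast_zero, eq_comm, Module.length_eq_zero_iff,
      Submodule.Quotient.subsingleton_iff, Ideal.span_singleton_eq_top] at hn
    exact hyf hn
  norm_cast
  rw [Multiplicative.ofAdd_le]
  omega

end Order

section Degree

variable {X Y : Scheme.{u}} [IsIntegral Y] [IsLocallyNoetherian Y] {ι : Y ⟶ X} {L : X.Modules}

/-- A section of an invertible sheaf with more zeros on a curve than the degree vanishes on the
curve. -/
lemma HasDegree.vanishesOn_range {n : ℤ} (hL : IsInvertible L) (hn : HasDegree ι L n)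
    (hY : ∀ y : Y, Order.coheight y ≤ 1) (T : Finset Y) (hT : n < T.card) {s : Γ(L, ⊤)}
    (hs : ∀ y ∈ T, VanishesAt L s (ι y) trivial) : VanishesOn L s (Set.range ι) := by
  suffices h : VanishesAt L s (ι (genericPoint Y)) trivial by
    rintro _ hx ⟨y, rfl⟩
    exact hL.vanishesAt_of_specializes ((genericPoint_specializes y).map ι.continuous) hx h
  by_contra hη
  -- If `s` is nonzero at the generic point, its divisor is effective and at least 1 at each point
  -- of `T`, so its degree is at least `T.card`, which exceeds `n`.
  obtain ⟨D, hD, hfin, hsum⟩ := hn ⊤ trivial s hη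
  have key : ∀ y, 0 ≤ D y ∧ (y ∈ T → 1 ≤ D y) := by
    intro y
    obtain ⟨V, hyV, e, g, hηV, he, hsg, hord⟩ := hD y
    have he' := he.restrict (W := ⊤ ⊓ V) inf_le_right
    have hvan : ∀ x (hx : x ∈ ⊤ ⊓ V), VanishesAt L s x trivial ↔ x ∉ X.basicOpen g := by
      intro x hx
      rw [← he'.vanishesAt_smul_iff hx, ← hsg, vanishesAt_res_iff]
    have hηg : genericPoint Y ∈ Y.basicOpen (ι.app _ g) := by
      rw [← Scheme.preimage_basicOpen]
      exact not_not.1 (fun h => hη ((hvan _ hηV).2 h))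
    have hg0 : ι.app _ g ≠ 0 := by
      intro h0
      rw [h0, Scheme.basicOpen_zero] at hηg
      exact hηg
    have hyV' : y ∈ ι ⁻¹ᵁ (⊤ ⊓ V) := ⟨trivial, hyV⟩
    rw [← hord]
    refine ⟨ord_germ_nonneg _ hyV' hg0, fun hyT => ?_⟩
    have hyg := (hvan (ι y) ⟨trivial, hyV⟩).1 (hs y hyT)
    refine one_le_ord_germ _ hyV' ?_ hg0 ?_
    -- A point of coheight zero specializes to the generic point, and the vanishing of `s` at `y`
    -- would propagate there.
    · refine le_antisymm (hY y) (Order.one_le_iff_ne_zero.2 (Order.coheight_ne_zero.2 fun hmax => ?_))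
      have hs' : y ⤳ genericPoint Y := hmax (genericPoint_specializes y)
      exact hη (hL.vanishesAt_of_specializes (hs'.map ι.continuous) _ (hs y hyT))
    · rw [← Scheme.preimage_basicOpen]
      exact hyg
  have hle : (T.card : ℤ) ≤ ∑ᶠ y, D y := by
    classical
    rw [finsum_eq_sum_of_support_subset (s := hfin.toFinset ∪ T) D (by simp)]
    calc (T.card : ℤ) = ∑ y ∈ T, 1 := by simp
      _ ≤ ∑ y ∈ T, D y := Finset.sum_le_sum fun y hy => (key y).2 hy
      _ ≤ _ := Finset.sum_le_sum_of_subset_of_nonneg Finset.subset_union_right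
        fun y _ _ => (key y).1
  omega

end Degree
end LLS

/-! ### Vanishing subspaces on the chain, including boundary multidegrees. -/

namespace LLS

namespace ChainCurve

variable {k : Type u} [Field k] (C : ChainCurve k)

lemma coheight_le_one (q : Fin 3) (y : C.comp q) : Order.coheight y ≤ 1 :=
  have := C.smooth q
  coheight_le_one_of_smooth (C.ι q ≫ C.str) y

lemma exists_A_zero : ∃ y, C.ι 0 y = C.A := (C.inter_one_two.ge rfl).1

lemma exists_A_one : ∃ y, C.ι 1 y = C.A := (C.inter_one_two.ge rfl).2

lemma exists_B_one : ∃ y, C.ι 1 y = C.B := (C.inter_two_three.ge rfl).1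

lemma exists_B_two : ∃ y, C.ι 2 y = C.B := (C.inter_two_three.ge rfl).2

end ChainCurve

namespace LimitLinearSeries

variable {k : Type u} [Field k] {C : ChainCurve k} {d r : ℕ} (S : LimitLinearSeries C d r)

/-- The components cover the reduced curve, so a section vanishing on all of them is zero. -/
lemma van_inf_eq_bot (m : Multidegree d) : S.van m 0 ⊓ S.van m 1 ⊓ S.van m 2 = ⊥ := by
  rw [eq_bot_iff]
  rintro s ⟨⟨⟨-, h0⟩, ⟨-, h1⟩⟩, ⟨-, h2⟩⟩
  have := C.reduced
  refine (S.invertible m).eq_zero_of_vanishesAt fun x hx => ?_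
  obtain ⟨q, hq⟩ := Set.mem_iUnion.1 (C.cover.ge (Set.mem_univ x))
  fin_cases q
  exacts [h0 x hx hq, h1 x hx hq, h2 x hx hq]

lemma vanCo_eq (m : Multidegree d) {u v w : Fin 3} (huv : u ≠ v) (hu : u ≠ w) (hv : v ≠ w) :
    S.vanCo m w = S.van m u ⊓ S.van m v := by
  ext s
  constructor
  · rintro ⟨hV, hs⟩
    exact ⟨⟨hV, fun x hx hxu => hs x hx (Set.mem_biUnion (by simpa using hu) hxu)⟩,
      ⟨hV, fun x hx hxv => hs x hx (Set.mem_biUnion (by simpa using hv) hxv)⟩⟩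
  · rintro ⟨⟨hV, hsu⟩, ⟨-, hsv⟩⟩
    refine ⟨hV, fun x hx hxw => ?_⟩
    obtain ⟨p, hp, hxp⟩ := Set.mem_iUnion₂.1 hxw
    have key : ∀ u v w p : Fin 3, u ≠ v → u ≠ w → v ≠ w → p ≠ w → p = u ∨ p = v := by decide
    rcases key u v w p huv hu hv (by simpa using hp) with rfl | rfl
    exacts [hsu x hx hxp, hsv x hx hxp]

lemma up_eq_zero {m m' : Multidegree d} {q : Fin 3} (h : IsTwist q m m') {s : C.H0 (S.L m)} :
    C.H0map (S.up q h) s = 0 ↔ s ∈ C.vanishing (S.L m) (C.coComponent q) :=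
  (S.up_factors q h).ker ⊤ s

lemma down_eq_zero {m m' : Multidegree d} {q : Fin 3} (h : IsTwist q m m') {s : C.H0 (S.L m')} :
    C.H0map (S.down q h) s = 0 ↔ s ∈ C.vanishing (S.L m') (C.component q) :=
  (S.down_factors q h).ker ⊤ s

lemma map_up_van_le {m m' : Multidegree d} {q : Fin 3} (h : IsTwist q m m') (p : Fin 3) :
    (S.van m p).map (C.H0map (S.up q h)) ≤ S.van m' p := by
  rintro _ ⟨s, ⟨hV, hs⟩, rfl⟩
  exact ⟨S.map_up_le q h (Submodule.mem_map_of_mem hV), fun x hx hxp =>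
    (S.invertible m).vanishesAt_app _ (hs x hx hxp)⟩

/-- A section with more zeros on a component than its degree there vanishes on the component. -/
lemma mem_van_of_card_lt {m : Multidegree d} {q : Fin 3} {s : C.H0 (S.L m)} (hV : s ∈ S.V m)
    (T : Finset (C.comp q)) (hT : m.deg q < T.card)
    (hs : ∀ y ∈ T, VanishesAt (S.L m) (U := ⊤) s (C.ι q y) trivial) : s ∈ S.van m q :=
  ⟨hV, (S.multidegree m q).vanishesOn_range (S.invertible m) (C.coheight_le_one q) T
    (by exact_mod_cast hT) hs⟩

/-- Vanishing on a component propagates to a component of degree zero that meets it. -/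
lemma van_le_van_of_deg_eq_zero {m : Multidegree d} {p q : Fin 3} (hq : m.deg q = 0)
    {y : C.comp q} {z : C.comp p} (hyz : C.ι q y = C.ι p z) : S.van m p ≤ S.van m q := by
  rintro s ⟨hV, hs⟩
  refine S.mem_van_of_card_lt hV {y} (by simp [hq]) fun y' hy' => ?_
  obtain rfl := Finset.mem_singleton.1 hy'
  exact hs _ _ ⟨z, hyz.symm⟩

lemma van_zero_le_van_one {m : Multidegree d} (h : m.deg 1 = 0) : S.van m 0 ≤ S.van m 1 := by
  obtain ⟨y, hy⟩ := C.exists_A_one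
  obtain ⟨z, hz⟩ := C.exists_A_zero
  exact S.van_le_van_of_deg_eq_zero h (hy.trans hz.symm)

lemma van_one_le_van_zero {m : Multidegree d} (h : m.deg 0 = 0) : S.van m 1 ≤ S.van m 0 := by
  obtain ⟨y, hy⟩ := C.exists_A_one
  obtain ⟨z, hz⟩ := C.exists_A_zero
  exact S.van_le_van_of_deg_eq_zero h (hz.trans hy.symm)

lemma van_two_le_van_one {m : Multidegree d} (h : m.deg 1 = 0) : S.van m 2 ≤ S.van m 1 := by
  obtain ⟨y, hy⟩ := C.exists_B_one
  obtain ⟨z, hz⟩ := C.exists_B_two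
  exact S.van_le_van_of_deg_eq_zero h (hy.trans hz.symm)

lemma van_one_le_van_two {m : Multidegree d} (h : m.deg 2 = 0) : S.van m 1 ≤ S.van m 2 := by
  obtain ⟨y, hy⟩ := C.exists_B_one
  obtain ⟨z, hz⟩ := C.exists_B_two
  exact S.van_le_van_of_deg_eq_zero h (hz.trans hy.symm)

/-- A section vanishing on both outer components has zeros at the two distinct nodes of the middle
one, where the degree is at most one. -/
lemma van_inf_van_le_of_deg_le_one {m : Multidegree d} (h : m.deg 1 ≤ 1) :
    S.van m 0 ⊓ S.van m 2 ≤ S.van m 1 := by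
  classical
  obtain ⟨y, hy⟩ := C.exists_A_one
  obtain ⟨z, hz⟩ := C.exists_B_one
  obtain ⟨y', hy'⟩ := C.exists_A_zero
  obtain ⟨z', hz'⟩ := C.exists_B_two
  have hyz : y ≠ z := by
    rintro rfl
    exact C.A_ne_B (hy.symm.trans hz)
  rintro s ⟨⟨hV, hs⟩, ⟨-, hs'⟩⟩
  refine S.mem_van_of_card_lt hV {y, z} (by rw [Finset.card_pair hyz]; omega) fun x hx => ?_
  rcases Finset.mem_insert.1 hx with rfl | hx
  · exact hs _ _ ⟨y', hy'.trans hy.symm⟩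
  · obtain rfl := Finset.mem_singleton.1 hx
    exact hs' _ _ ⟨z', hz'.trans hz.symm⟩

/-- This replaces exactness when m - t_q has a negative entry. Then some neighbouring component has
degree zero, and the zero at the common node forces vanishing on it. -/
lemma exists_van_le {m : Multidegree d} {q : Fin 3} (h : ¬ ∃ a, IsTwist q a m) :
    ∃ p, p ≠ q ∧ S.van m q ≤ S.van m p := by
  fin_cases q
  · exact ⟨1, by decide, S.van_zero_le_van_one (by
      by_contra h'
      exact h (mk_isTwist_zero m (by omega)))⟩
  · by_cases h0 : m.deg 0 = 0
    · exact ⟨0, by decide, S.van_one_le_van_zero h0⟩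
    · exact ⟨2, by decide, S.van_one_le_van_two (by
        by_contra h'
        exact h (mk_isTwist_one m (by omega) (by omega)))⟩
  · exact ⟨1, by decide, S.van_two_le_van_one (by
      by_contra h'
      exact h (mk_isTwist_two m (by omega)))⟩

/-- If m + t_q has a negative entry, the degree on component q is smaller than its number of nodes
(1, 2, 1 respectively). Vanishing on the other two components then extends to component q. -/
lemma vanCo_eq_bot {m : Multidegree d} {q : Fin 3} (h : ¬ ∃ a, IsTwist q m a) :
    S.vanCo m q = ⊥ := by
  rw [eq_bot_iff, ← S.van_inf_eq_bot m]
  fin_cases q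
  · change S.vanCo m 0 ≤ _
    rw [S.vanCo_eq m (u := 1) (v := 2) (by decide) (by decide) (by decide)]
    exact le_inf (le_inf (inf_le_left.trans (S.van_one_le_van_zero (by
      by_contra h'
      exact h (isTwist_zero_mk m (by omega))))) inf_le_left) inf_le_right
  · change S.vanCo m 1 ≤ _
    rw [S.vanCo_eq m (u := 0) (v := 2) (by decide) (by decide) (by decide)]
    exact le_inf (le_inf inf_le_left (S.van_inf_van_le_of_deg_le_one (by
      by_contra h'
      exact h (isTwist_one_mk m (by omega))))) inf_le_right
  · change S.vanCo m 2 ≤ _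
    rw [S.vanCo_eq m (u := 0) (v := 1) (by decide) (by decide) (by decide)]
    exact le_inf le_rfl (inf_le_right.trans (S.van_one_le_van_two (by
      by_contra h'
      exact h (isTwist_two_mk m (by omega)))))

end LimitLinearSeries
end LLS

/-! ### Consequences of distributivity and exactness in a single multidegree. -/

noncomputable section

namespace LLS

/-- Distributivity for three submodules is symmetric. If b = a + c, then a = b - c lies in A ⊓ (B ⊔
D) and splits as x + y with x in A ⊓ B and y in A ⊓ D; hence b = x + (y + c), where y + c = b - x
lies in B ⊓ D. -/
lemma inf_sup_le_swap {R M : Type*} [Ring R] [AddCommGroup M] [Module R M]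
    {A B D : Submodule R M} (h : A ⊓ (B ⊔ D) ≤ A ⊓ B ⊔ A ⊓ D) : B ⊓ (A ⊔ D) ≤ B ⊓ A ⊔ B ⊓ D := by
  rintro b ⟨hb, hb'⟩
  obtain ⟨a, ha, c, hc, rfl⟩ := Submodule.mem_sup.1 hb'
  have : a ∈ A ⊓ (B ⊔ D) :=
    ⟨ha, Submodule.mem_sup.2 ⟨a + c, hb, -c, neg_mem hc, by abel⟩⟩
  obtain ⟨x, hx, y, hy, rfl⟩ := Submodule.mem_sup.1 (h this)
  refine Submodule.mem_sup.2 ⟨x, ⟨hx.2, hx.1⟩, y + c, ⟨?_, add_mem hy.2 hc⟩, by abel⟩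
  have := sub_mem hb hx.2
  rwa [show x + y + c - x = y + c by abel] at this

namespace LimitLinearSeries

variable {k : Type u} [Field k] {C : ChainCurve k} {d r : ℕ} {S : LimitLinearSeries C d r}

lemma Distributive.inf_sup_le {m : Multidegree d} (h : S.Distributive m) {u v w : Fin 3} (huv : u ≠ v)
    (hu : u ≠ w) (hv : v ≠ w) :
    S.van m u ⊓ (S.van m v ⊔ S.van m w) ≤ S.van m u ⊓ S.van m v ⊔ S.van m u ⊓ S.van m w := by
  have h0 := le_of_eq h
  have h1 := inf_sup_le_swap h0
  have h2 := inf_sup_le_swap ((sup_comm (S.van m 2) (S.van m 1)) ▸ (h0.trans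
    (sup_comm _ _).le))
  fin_cases u <;> fin_cases v <;> fin_cases w <;> simp at huv hu hv ⊢
  · exact h0
  · rw [sup_comm, sup_comm (S.van m 0 ⊓ S.van m 2)]; exact h0
  · exact h1
  · rw [sup_comm, sup_comm (S.van m 1 ⊓ S.van m 2)]; exact h1
  · exact h2
  · rw [sup_comm, sup_comm (S.van m 2 ⊓ S.van m 1)]; exact h2

variable (S)

lemma van_le (m : Multidegree d) (q : Fin 3) : S.van m q ≤ S.V m := inf_le_left

lemma vanSum_le (m : Multidegree d) : S.vanSum m ≤ S.V m :=
  sup_le (sup_le (S.van_le m 0) (S.van_le m 1)) (S.van_le m 2)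

lemma van_le_vanSum (m : Multidegree d) (q : Fin 3) : S.van m q ≤ S.vanSum m := by
  fin_cases q
  · exact le_sup_left.trans le_sup_left
  · exact le_sup_right.trans le_sup_left
  · exact le_sup_right

lemma vanSum_eq (m : Multidegree d) {u v w : Fin 3} (huv : u ≠ v) (hu : u ≠ w) (hv : v ≠ w) :
    S.vanSum m = S.van m u ⊔ S.van m v ⊔ S.van m w := by
  refine le_antisymm ?_ (sup_le (sup_le (S.van_le_vanSum m u) (S.van_le_vanSum m v))
    (S.van_le_vanSum m w))
  have : ∀ q, S.van m q ≤ S.van m u ⊔ S.van m v ⊔ S.van m w := by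
    intro q
    have : ∀ u v w q : Fin 3, u ≠ v → u ≠ w → v ≠ w → q = u ∨ q = v ∨ q = w := by decide
    rcases this u v w q huv hu hv with rfl | rfl | rfl
    · exact le_sup_left.trans le_sup_left
    · exact le_sup_right.trans le_sup_left
    · exact le_sup_right
  exact sup_le (sup_le (this 0) (this 1)) (this 2)

lemma along_mem {a b : Multidegree d} (p : LinkPath a b) {s : C.H0 (S.L a)} (hs : s ∈ S.V a) :
    S.along p s ∈ S.V b := by
  induction p with
  | nil => rwa [LinkedSheaves.along]
  | up p q h ih =>
    rw [LinkedSheaves.along]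
    exact S.map_up_le q h (Submodule.mem_map_of_mem ih)
  | down p q h ih =>
    rw [LinkedSheaves.along]
    exact S.map_down_le q h (Submodule.mem_map_of_mem ih)

lemma link_mem (a b : Multidegree d) {s : C.H0 (S.L a)} (hs : s ∈ S.V a) :
    S.link a b s ∈ S.V b := S.along_mem _ hs

variable {S}

lemma IsExact.vanCo_eq_map (hS : S.IsExact) {m b : Multidegree d} {w : Fin 3}
    (h : IsTwist w m b) : S.vanCo m w = (S.V b).map (C.H0map (S.down w h)) :=
  (hS m b w h).2.symm

lemma IsExact.van_eq_map (hS : S.IsExact) {m a : Multidegree d} {u : Fin 3}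
    (h : IsTwist u a m) : S.van m u = (S.V a).map (C.H0map (S.up u h)) :=
  (hS a m u h).1.symm

/-- The intersection is `vanCo m w`, the image of `V b` for b = m + t_w under the map subtracting
t_w. That map factors through a = b + t_v, where the image of `V b` is exactly `van a v`. -/
lemma IsExact.van_inf_van_le (hS : S.IsExact) {m a : Multidegree d} {u v w : Fin 3} (huv : u ≠ v)
    (hu : u ≠ w) (hv : v ≠ w) (h : IsTwist u a m) :
    S.van m u ⊓ S.van m v ≤ (S.van a v).map (C.H0map (S.up u h)) := by
  rw [← S.vanCo_eq m huv hu hv]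
  by_cases hb : ∃ b, IsTwist w m b
  · obtain ⟨b, hb⟩ := hb
    have hba : IsTwist v b a := h.of_sum huv hu hv hb
    rw [hS.vanCo_eq_map hb, ← S.H0map_up_up huv.symm hba h hb, Submodule.map_comp,
      hS.van_eq_map hba]
  · rw [S.vanCo_eq_bot hb]
    exact bot_le

/-! ### Generation by the links -/

section Span

variable (W : ∀ m, Submodule k (C.H0 (S.L m)))

/-- The span of the images in degree `m` of the `W y` for `y` satisfying `P`. -/
def linkSpan (m : Multidegree d) (P : Multidegree d → Prop) : Submodule k (C.H0 (S.L m)) :=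
  ⨆ y, ⨆ (_ : P y), (W y).map (S.link y m)

variable {W}

lemma le_linkSpan {m y : Multidegree d} {P : Multidegree d → Prop} (h : P y) :
    (W y).map (S.link y m) ≤ linkSpan W m P :=
  le_iSup₂_of_le y h le_rfl

lemma linkSpan_mono {m : Multidegree d} {P Q : Multidegree d → Prop} (h : ∀ y, P y → Q y) :
    linkSpan W m P ≤ linkSpan W m Q :=
  iSup₂_le fun y hy => le_linkSpan (h y hy)

lemma self_le_linkSpan {m : Multidegree d} {P : Multidegree d → Prop} (h : P m) :
    W m ≤ linkSpan W m P := by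
  have := le_linkSpan (W := W) (m := m) h
  rwa [LinkedSheaves.link_self, Submodule.map_id] at this

lemma map_linkSpan_le {m a : Multidegree d} {P Q : Multidegree d → Prop}
    (f : C.H0 (S.L a) →ₗ[k] C.H0 (S.L m))
    (h : ∀ y, P y → Q y ∧ S.link y m = f ∘ₗ S.link y a) :
    (linkSpan W a P).map f ≤ linkSpan W m Q := by
  simp only [linkSpan, Submodule.map_iSup]
  refine iSup₂_le fun y hy => ?_
  rw [← Submodule.map_comp, ← (h y hy).2]
  exact le_linkSpan (h y hy).1

lemma map_up_linkSpan_ray_le {m a : Multidegree d} {u : Fin 3} (h : IsTwist u a m) :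
    (linkSpan W a fun y => ∀ p, p ≠ u → coef y a p = 0).map (C.H0map (S.up u h)) ≤
      linkSpan W m fun y => ∀ p, p ≠ u → coef y m p = 0 := by
  refine map_linkSpan_le _ fun y hy => ?_
  obtain ⟨v, w, huv, huw, -⟩ := exists_ne_ne u
  exact ⟨fun p hp => (coef_up h (hy p hp) hp.symm).1, S.link_up h (hy v huv.symm) huv⟩

lemma map_down_linkSpan_sector_le {m b : Multidegree d} {w : Fin 3} (h : IsTwist w m b) :
    (linkSpan W b fun y => coef y b w = 0).map (C.H0map (S.down w h)) ≤
      linkSpan W m fun y => coef y m w = 0 :=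
  map_linkSpan_le _ fun _ hy => ⟨(coef_down h hy).1, S.link_down h hy⟩

variable (hsup : ∀ m, S.vanSum m ⊔ W m = S.V m)

include hsup

/-- Exactness writes `van m u` as the image of `V a`, a = m - t_u. Decomposing `V a` into its
complement and its three `van`, the u-part is handled by induction along the ray, while the v- and
w-parts map into sections that vanish on u and also on v or w. -/
lemma IsExact.van_le_ray (hS : S.IsExact) {u v w : Fin 3} (huv : u ≠ v) (hu : u ≠ w) (hv : v ≠ w)
    (m : Multidegree d) : S.van m u ≤ (linkSpan W m fun y => ∀ p, p ≠ u → coef y m p = 0) ⊔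
      S.van m u ⊓ S.van m v ⊔ S.van m u ⊓ S.van m w := by
  obtain ⟨n, hn⟩ := exists_deg_lt (d := d) u
  induction hN : m.deg n using Nat.strong_induction_on generalizing m with
  | _ N ih =>
  by_cases ha : ∃ a, IsTwist u a m
  · obtain ⟨a, ha⟩ := ha
    have hV : S.V a ≤ (linkSpan W a fun y => ∀ p, p ≠ u → coef y a p = 0) ⊔
        S.van a v ⊔ S.van a w := by
      rw [← hsup a, S.vanSum_eq a huv hu hv]
      refine sup_le (sup_le (sup_le ?_ (le_sup_right.trans le_sup_left)) le_sup_right) ?_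
      · exact (ih _ (hN ▸ hn a m ha) a rfl).trans (sup_le_sup (sup_le_sup le_rfl inf_le_right)
          inf_le_right)
      · exact (self_le_linkSpan fun p _ => coef_self a p).trans (le_sup_left.trans le_sup_left)
    have hmap : ∀ p, (S.van a p).map (C.H0map (S.up u ha)) ≤ S.van m u ⊓ S.van m p := fun p =>
      le_inf ((Submodule.map_mono (S.van_le a p)).trans (hS.van_eq_map ha).ge)
        (S.map_up_van_le ha p)
    refine (hS.van_eq_map ha).le.trans ((Submodule.map_mono hV).trans ?_)
    rw [Submodule.map_sup, Submodule.map_sup]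
    exact sup_le_sup (sup_le_sup (map_up_linkSpan_ray_le ha) (hmap v)) (hmap w)
  · obtain ⟨p, hp, hle⟩ := S.exists_van_le ha
    rcases eq_or_eq_or_eq huv hu hv p with rfl | rfl | rfl
    · exact absurd rfl hp
    · exact (le_inf le_rfl hle).trans (le_sup_right.trans le_sup_left)
    · exact (le_inf le_rfl hle).trans le_sup_right

/-- Exactness writes `vanCo m w` as the image of `V b`, b = m + t_w, under a map that kills `van b
w`. Modulo `van b w`, the ray decompositions of the other two `van b u` leave only ray contributions
and `vanCo b w`, to which induction applies. -/
lemma IsExact.vanCo_le_sector (hS : S.IsExact) (w : Fin 3) (m : Multidegree d) :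
    S.vanCo m w ≤ linkSpan W m fun y => coef y m w = 0 := by
  induction hN : m.deg w using Nat.strong_induction_on generalizing m with
  | _ N ih =>
  by_cases hb : ∃ b, IsTwist w m b
  · obtain ⟨b, hb⟩ := hb
    have key : ∀ u v, u ≠ v → u ≠ w → v ≠ w →
        S.van b u ≤ (linkSpan W b fun y => coef y b w = 0) ⊔ S.van b w := by
      intro u v huv hu hv
      -- The rays u and v lie in the closed sector of w, which explains the index condition c_w = 0.
      refine (hS.van_le_ray hsup huv hu hv b).trans (sup_le (sup_le ?_ ?_) ?_)
      · exact (linkSpan_mono fun y hy => hy w hu.symm).trans le_sup_left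
      · rw [← S.vanCo_eq b huv hu hv]
        exact (ih _ (hN ▸ hb.deg_lt) b rfl).trans le_sup_left
      · exact inf_le_right.trans le_sup_right
    have hV : S.V b ≤ (linkSpan W b fun y => coef y b w = 0) ⊔ S.van b w := by
      obtain ⟨u, v, hu, hv, huv⟩ := exists_ne_ne w
      rw [← hsup b, S.vanSum_eq b huv hu.symm hv.symm]
      exact sup_le (sup_le (sup_le (key u v huv hu.symm hv.symm) (key v u huv.symm hv.symm hu.symm))
        le_sup_right) ((self_le_linkSpan (coef_self b w)).trans le_sup_left)
    refine (hS.vanCo_eq_map hb).le.trans ((Submodule.map_mono hV).trans ?_)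
    rw [Submodule.map_sup]
    refine sup_le (map_down_linkSpan_sector_le hb) ?_
    rintro _ ⟨s, hs, rfl⟩
    rw [(S.down_eq_zero hb).2 hs.2]
    exact zero_mem _
  · rw [S.vanCo_eq_bot hb]
    exact bot_le

/-- Complements of the `vanSum` generate under the link maps. -/
lemma IsExact.le_linkSpan (hS : S.IsExact) (m : Multidegree d) :
    S.V m ≤ linkSpan W m fun _ => True := by
  have hco : ∀ w, S.vanCo m w ≤ linkSpan W m fun _ => True := fun w =>
    (hS.vanCo_le_sector hsup w m).trans (linkSpan_mono fun _ _ => trivial)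
  have key : ∀ u, S.van m u ≤ linkSpan W m fun _ => True := by
    intro u
    obtain ⟨v, w, huv, hu, hv⟩ := exists_ne_ne u
    refine (hS.van_le_ray hsup huv hu hv m).trans (sup_le (sup_le ?_ ?_) ?_)
    · exact linkSpan_mono fun _ _ => trivial
    · rw [← S.vanCo_eq m huv hu hv]
      exact hco w
    · rw [← S.vanCo_eq m hu huv hv.symm]
      exact hco v
  rw [← hsup m]
  exact sup_le (sup_le (sup_le (key 0) (key 1)) (key 2)) (self_le_linkSpan trivial)

end Span

/-! ### Independence of the links -/

section Independent

open scoped Classical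

variable (x : ∀ m, C.H0 (S.L m))

/-- The sum of the images in degree `m` of the `x y` for `y` satisfying `P`. -/
def linkSum (m : Multidegree d) (P : Multidegree d → Prop) : C.H0 (S.L m) :=
  ∑ᶠ y, if P y then S.link y m (x y) else 0

variable {x}

lemma linkSum_eq_zero {m : Multidegree d} {P : Multidegree d → Prop} (h : ∀ y, P y → x y = 0) :
    linkSum x m P = 0 := by
  refine finsum_eq_zero_of_forall_eq_zero fun y => ?_
  split_ifs with hy
  · rw [h y hy, map_zero]
  · rfl

lemma linkSum_self (m : Multidegree d) : (linkSum x m fun y => ∀ p, coef y m p = 0) = x m := by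
  rw [linkSum, finsum_eq_single _ m]
  · rw [if_pos (coef_self m), LinkedSheaves.link_self, LinearMap.id_apply]
  · intro y hy
    rw [if_neg fun h => hy (eq_of_coef_eq_zero h)]

lemma linkSum_congr {m : Multidegree d} {P Q : Multidegree d → Prop} (h : ∀ y, P y ↔ Q y) :
    linkSum x m P = linkSum x m Q := by
  rw [funext fun y => propext (h y)]

lemma linkSum_or {m : Multidegree d} {P Q : Multidegree d → Prop} (h : ∀ y, P y → ¬ Q y) :
    (linkSum x m fun y => P y ∨ Q y) = linkSum x m P + linkSum x m Q := by
  rw [linkSum, linkSum, linkSum, ← finsum_add_distrib (Set.toFinite _) (Set.toFinite _)]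
  refine finsum_congr fun y => ?_
  have := h y
  by_cases h1 : P y <;> by_cases h2 : Q y <;> simp_all

lemma linkSum_mem (hx : ∀ y, x y ∈ S.V y) (m : Multidegree d) (P : Multidegree d → Prop) :
    linkSum x m P ∈ S.V m := by
  refine finsum_induction (· ∈ S.V m) (zero_mem _) (fun _ _ => add_mem) fun y => ?_
  split_ifs
  · exact S.link_mem y m (hx y)
  · exact zero_mem _

lemma map_linkSum {m a : Multidegree d} {P Q : Multidegree d → Prop}
    (f : C.H0 (S.L a) →ₗ[k] C.H0 (S.L m)) (hPQ : ∀ y, P y ↔ Q y)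
    (h : ∀ y, P y → S.link y m = f ∘ₗ S.link y a) :
    f (linkSum x a P) = linkSum x m Q := by
  rw [linkSum, linkSum, map_finsum _ (Set.toFinite _)]
  refine finsum_congr fun y => ?_
  by_cases hy : P y
  · rw [if_pos hy, if_pos ((hPQ y).1 hy), h y hy, LinearMap.comp_apply]
  · rw [if_neg hy, if_neg fun h => hy ((hPQ y).2 h), map_zero]

/-- The degrees linked to `m` by adding `u` only. -/
def OnRay (u : Fin 3) (m y : Multidegree d) : Prop := coef y m u ≠ 0 ∧ ∀ p, p ≠ u → coef y m p = 0

/-- The degrees linked to `m` by adding both twists other than `w`. -/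
def InSector (w : Fin 3) (m y : Multidegree d) : Prop :=
  coef y m w = 0 ∧ ∀ p, p ≠ w → coef y m p ≠ 0

variable (x) in
lemma up_linkSum {m a : Multidegree d} {u : Fin 3} (h : IsTwist u a m) :
    C.H0map (S.up u h) (linkSum x a fun y => ∀ p, p ≠ u → coef y a p = 0) =
      linkSum x m (OnRay u m) := by
  obtain ⟨v, w, huv, huw, -⟩ := exists_ne_ne u
  refine map_linkSum _ (fun y => ⟨fun hy => ⟨?_, fun p hp => ?_⟩, fun hy p hp => ?_⟩)
    fun y hy => S.link_up h (hy v huv.symm) huv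
  · rw [(coef_up h (hy v huv.symm) huv).2]
    simp
  · exact (coef_up h (hy p hp) hp.symm).1
  · exact coef_of_up h (hy.2 p hp) hy.1

variable (x) in
lemma down_linkSum {m b : Multidegree d} {w : Fin 3} (h : IsTwist w m b) :
    C.H0map (S.down w h) (linkSum x b fun y => coef y b w = 0) =
      linkSum x m (InSector w m) := by
  refine map_linkSum _ (fun y => ⟨fun hy => ⟨(coef_down h hy).1, fun p hp => ?_⟩,
    fun hy => coef_of_down h hy.1 hy.2⟩) fun y hy => S.link_down h hy
  rw [(coef_down h hy).2, if_neg hp]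
  simp

variable (x) in
lemma linkSum_ray (m : Multidegree d) (u : Fin 3) :
    (linkSum x m fun y => ∀ p, p ≠ u → coef y m p = 0) = x m + linkSum x m (OnRay u m) := by
  rw [← linkSum_self (x := x) m, ← linkSum_or fun y h h' => h'.1 (h u)]
  refine linkSum_congr fun y => ⟨fun h => ?_, ?_⟩
  · by_cases hu : coef y m u = 0
    · exact Or.inl fun p => (eq_or_ne p u).elim (fun e => e ▸ hu) (h p)
    · exact Or.inr ⟨hu, h⟩
  · rintro (h | h) p hp
    · exact h p
    · exact h.2 p hp

variable (x) in
lemma linkSum_sector (m : Multidegree d) {u v w : Fin 3} (huv : u ≠ v) (hu : u ≠ w)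
    (hv : v ≠ w) : (linkSum x m fun y => coef y m w = 0) =
      x m + linkSum x m (OnRay u m) + linkSum x m (OnRay v m) + linkSum x m (InSector w m) := by
  have hall : ∀ P : Fin 3 → Prop, (∀ p, P p) ↔ P u ∧ P v ∧ P w := fun P =>
    ⟨fun h => ⟨h u, h v, h w⟩, fun h p => by
      rcases eq_or_eq_or_eq huv hu hv p with rfl | rfl | rfl
      exacts [h.1, h.2.1, h.2.2]⟩
  rw [← linkSum_self (x := x) m, ← linkSum_or, ← linkSum_or, ← linkSum_or]
  · refine linkSum_congr fun y => ?_
    simp only [OnRay, InSector, hall, ne_eq, huv, hu, hv, huv.symm, hu.symm, hv.symm,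
      not_true_eq_false, not_false_eq_true, false_imp_iff, true_imp_iff, true_and, and_true]
    tauto
  all_goals
    intro y
    simp only [OnRay, InSector, hall, ne_eq, huv, hu, hv, huv.symm, hu.symm, hv.symm,
      not_true_eq_false, not_false_eq_true, false_imp_iff, true_imp_iff, true_and, and_true]
    tauto

variable (x) in
-- This is the partition of all sources into the point `m`, three rays and three open sectors; it is
-- exhaustive because some coefficient is always zero.
lemma linkSum_true (m : Multidegree d) : (linkSum x m fun _ => True) =
    x m + (linkSum x m (OnRay 0 m) + linkSum x m (OnRay 1 m) + linkSum x m (OnRay 2 m)) +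
      (linkSum x m (InSector 0 m) + linkSum x m (InSector 1 m) + linkSum x m (InSector 2 m)) := by
  rw [← linkSum_self (x := x) m]
  simp only [← add_assoc]
  rw [← linkSum_or, ← linkSum_or, ← linkSum_or, ← linkSum_or, ← linkSum_or, ← linkSum_or]
  · refine linkSum_congr fun y => ?_
    have := exists_coef_eq_zero y m
    simp only [OnRay, InSector, Fin.forall_fin_succ, Fin.exists_fin_succ] at this ⊢
    by_cases h0 : coef y m 0 = 0 <;> by_cases h1 : coef y m 1 = 0 <;>
      by_cases h2 : coef y m 2 = 0 <;> simp_all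
  all_goals
    intro y
    simp only [OnRay, InSector, Fin.forall_fin_succ]
    by_cases h0 : coef y m 0 = 0 <;> by_cases h1 : coef y m 1 = 0 <;>
      by_cases h2 : coef y m 2 = 0 <;> simp [h0, h1, h2]

variable (W : ∀ m, Submodule k (C.H0 (S.L m))) (hdisj : ∀ m, Disjoint (S.vanSum m) (W m))
  (hx : ∀ y, x y ∈ S.V y) (hxW : ∀ y, x y ∈ W y)

include hx in
lemma IsExact.linkSum_onRay_mem (hS : S.IsExact) (m : Multidegree d) (u : Fin 3) :
    linkSum x m (OnRay u m) ∈ S.van m u := by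
  by_cases ha : ∃ a, IsTwist u a m
  · obtain ⟨a, ha⟩ := ha
    rw [← up_linkSum x ha, hS.van_eq_map ha]
    exact Submodule.mem_map_of_mem (linkSum_mem hx _ _)
  · rw [linkSum, finsum_eq_zero_of_forall_eq_zero]
    · exact zero_mem _
    · exact fun y => if_neg fun hy => ha (exists_isTwist_of_ray hy.1 hy.2)

include hx in
-- All links from the open sector factor through m + t_w, so their sum lies in `vanCo m w`. If m +
-- t_w is not a multidegree, the sector is empty.
lemma IsExact.linkSum_inSector_mem (hS : S.IsExact) (m : Multidegree d) {u w : Fin 3}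
    (hu : u ≠ w) : linkSum x m (InSector w m) ∈ S.van m u := by
  by_cases hb : ∃ b, IsTwist w m b
  · obtain ⟨b, hb⟩ := hb
    obtain ⟨v, huv, hv⟩ : ∃ v : Fin 3, u ≠ v ∧ v ≠ w := by
      have : ∀ u w : Fin 3, u ≠ w → ∃ v, u ≠ v ∧ v ≠ w := by decide
      exact this u w hu
    have : linkSum x m (InSector w m) ∈ S.vanCo m w := by
      rw [← down_linkSum x hb, hS.vanCo_eq_map hb]
      exact Submodule.mem_map_of_mem (linkSum_mem hx _ _)
    rw [S.vanCo_eq m huv hu hv] at this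
    exact this.1
  · rw [linkSum, finsum_eq_zero_of_forall_eq_zero]
    · exact zero_mem _
    · exact fun y => if_neg fun hy => hb (exists_isTwist_of_sector hy.1 hy.2)

include hdisj hxW in
lemma eq_zero_of_mem_vanSum {m : Multidegree d} (h : x m ∈ S.vanSum m) : x m = 0 :=
  Submodule.disjoint_def.1 (hdisj m) _ h (hxW m)

include hdisj hx hxW

/-- The hypothesis is stated modulo `van m v ⊔ van m w` so that it reproduces itself at the
preceding point of the ray, where the sum of links is known only modulo the kernel of the next map.
-/
lemma IsExact.eq_zero_of_ray (hS : S.IsExact) (hdist : ∀ m, S.Distributive m) {u v w : Fin 3}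
    (huv : u ≠ v) (hu : u ≠ w) (hv : v ≠ w) (m : Multidegree d)
    (h : (linkSum x m fun y => ∀ p, p ≠ u → coef y m p = 0) ∈ S.van m v ⊔ S.van m w) :
    ∀ y, (∀ p, p ≠ u → coef y m p = 0) → x y = 0 := by
  obtain ⟨n, hn⟩ := exists_deg_lt (d := d) u
  induction hN : m.deg n using Nat.strong_induction_on generalizing m with
  | _ N ih =>
  have ht := hS.linkSum_onRay_mem hx m u
  have hsum := linkSum_ray x m u
  have hxm : x m = 0 := by
    refine eq_zero_of_mem_vanSum W hdisj hxW ?_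
    rw [eq_sub_of_add_eq hsum.symm, S.vanSum_eq m huv hu hv, sup_assoc]
    exact sub_mem (Submodule.mem_sup_right h) (Submodule.mem_sup_left ht)
  rw [hxm, zero_add] at hsum
  intro y hy
  by_cases hyu : coef y m u = 0
  · obtain rfl : y = m := eq_of_coef_eq_zero fun p =>
      (eq_or_ne p u).elim (fun e => e ▸ hyu) (hy p)
    exact hxm
  obtain ⟨a, ha⟩ := exists_isTwist_of_ray hyu hy
  refine ih _ (hN ▸ hn a m ha) a ?_ rfl y fun p hp => coef_of_up ha (hy p hp) hyu
  -- Distributivity splits the ray term into parts vanishing on u, v and on u, w. Exactness lifts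
  -- them to `t` in `van a v` and `t'` in `van a w`.
  have hmem := (hdist m).inf_sup_le huv hu hv ⟨ht, hsum ▸ h⟩
  obtain ⟨z, hz, z', hz', hzz⟩ := Submodule.mem_sup.1 hmem
  obtain ⟨t, ht, rfl⟩ := hS.van_inf_van_le huv hu hv ha hz
  obtain ⟨t', ht', rfl⟩ := hS.van_inf_van_le hu huv hv.symm ha hz'
  rw [← up_linkSum x ha, ← map_add] at hzz
  set R := linkSum x a fun y => ∀ p, p ≠ u → coef y a p = 0
  have h0 : C.H0map (S.up u ha) (R - (t + t')) = 0 := by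
    rw [map_sub, hzz, sub_self]
  -- The kernel of adding t_u consists of the sections vanishing on both v and w, so the ambiguity
  -- of the lift stays inside `van a v ⊔ van a w`.
  have hV : R - (t + t') ∈ S.vanCo a u :=
    ⟨sub_mem (linkSum_mem hx _ _) (add_mem ht.1 ht'.1), (S.up_eq_zero ha).1 h0⟩
  rw [S.vanCo_eq a hv huv.symm hu.symm] at hV
  rw [← sub_add_cancel R (t + t')]
  exact add_mem (Submodule.mem_sup_left hV.1)
    (add_mem (Submodule.mem_sup_left ht) (Submodule.mem_sup_right ht'))

lemma IsExact.linkSum_onRay_eq_zero (hS : S.IsExact) (hdist : ∀ m, S.Distributive m)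
    {u v w : Fin 3} (huv : u ≠ v) (hu : u ≠ w) (hv : v ≠ w) (m : Multidegree d) (hxm : x m = 0)
    (h : linkSum x m (OnRay u m) ∈ S.van m v ⊔ S.van m w) :
    (∀ y, (∀ p, p ≠ u → coef y m p = 0) → x y = 0) ∧ linkSum x m (OnRay u m) = 0 := by
  have h1 := hS.eq_zero_of_ray W hdisj hx hxW hdist huv hu hv m
    (by rwa [linkSum_ray, hxm, zero_add])
  exact ⟨h1, linkSum_eq_zero fun y hy => h1 y hy.2⟩

/-- Membership in `van m w` is what is inherited: `van b w` is the part of `V b` killed by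
subtracting t_w, and once the open sector term at `m` is zero, the closed sector sum at `b` lies in
it. -/
lemma IsExact.eq_zero_of_sector (hS : S.IsExact) (hdist : ∀ m, S.Distributive m) {w : Fin 3}
    (m : Multidegree d) (h : (linkSum x m fun y => coef y m w = 0) ∈ S.van m w) :
    ∀ y, coef y m w = 0 → x y = 0 := by
  induction hN : m.deg w using Nat.strong_induction_on generalizing m with
  | _ N ih =>
  obtain ⟨u, v, hu, hv, huv⟩ := exists_ne_ne w
  have htu := hS.linkSum_onRay_mem hx m u
  have htv := hS.linkSum_onRay_mem hx m v
  have hou := hS.linkSum_inSector_mem hx m hu.symm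
  have hov := hS.linkSum_inSector_mem hx m hv.symm
  have hsum := linkSum_sector x m huv hu.symm hv.symm
  set T := linkSum x m fun y => coef y m w = 0
  set tu := linkSum x m (OnRay u m)
  set tv := linkSum x m (OnRay v m)
  set o := linkSum x m (InSector w m)
  have hxm : x m = 0 := by
    refine eq_zero_of_mem_vanSum W hdisj hxW ?_
    rw [show x m = T - tu - tv - o by rw [hsum]; abel]
    exact sub_mem (sub_mem (sub_mem (S.van_le_vanSum m w h) (S.van_le_vanSum m u htu))
      (S.van_le_vanSum m v htv)) (S.van_le_vanSum m v hov)
  rw [hxm, zero_add] at hsum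
  obtain ⟨hyu, hu0⟩ := hS.linkSum_onRay_eq_zero W hdisj hx hxW hdist huv hu.symm hv.symm m hxm (by
    rw [show linkSum x m (OnRay u m) = -(tv + o) + T by rw [hsum]; abel]
    exact add_mem (Submodule.mem_sup_left (neg_mem (add_mem htv hov))) (Submodule.mem_sup_right h))
  obtain ⟨hyv, hv0⟩ := hS.linkSum_onRay_eq_zero W hdisj hx hxW hdist huv.symm hv.symm hu.symm m
    hxm (by
      rw [show linkSum x m (OnRay v m) = -(tu + o) + T by rw [hsum]; abel]
      exact add_mem (Submodule.mem_sup_left (neg_mem (add_mem htu hou)))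
        (Submodule.mem_sup_right h))
  -- With the ray terms gone, `o` is the whole sector sum, so it vanishes on w by hypothesis and on
  -- u and v as a sector term.
  have ho : o = 0 := by
    have how : o ∈ S.van m w := by
      rwa [hsum, show tu = 0 from hu0, show tv = 0 from hv0, zero_add, zero_add] at h
    have hall : ∀ q, o ∈ S.van m q := fun q => by
      rcases eq_or_eq_or_eq huv hu.symm hv.symm q with rfl | rfl | rfl
      exacts [hou, hov, how]
    have : o ∈ S.van m 0 ⊓ S.van m 1 ⊓ S.van m 2 := ⟨⟨hall 0, hall 1⟩, hall 2⟩
    rwa [S.van_inf_eq_bot] at this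
  intro y hy
  by_cases h1 : coef y m u = 0
  · refine hyv y fun p hp => ?_
    rcases eq_or_eq_or_eq huv hu.symm hv.symm p with rfl | rfl | rfl
    exacts [h1, absurd rfl hp, hy]
  by_cases h2 : coef y m v = 0
  · refine hyu y fun p hp => ?_
    rcases eq_or_eq_or_eq huv hu.symm hv.symm p with rfl | rfl | rfl
    exacts [absurd rfl hp, h2, hy]
  have hne : ∀ p, p ≠ w → coef y m p ≠ 0 := fun p hp => by
    rcases eq_or_eq_or_eq huv hu.symm hv.symm p with rfl | rfl | rfl
    exacts [h1, h2, absurd rfl hp]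
  obtain ⟨b, hb⟩ := exists_isTwist_of_sector hy hne
  refine ih _ (hN ▸ hb.deg_lt) b ⟨linkSum_mem hx _ _, ?_⟩ rfl y (coef_of_down hb hy hne)
  refine (S.down_eq_zero hb).1 ?_
  exact (down_linkSum x hb).trans ho

/-- Complements of the `vanSum` are independent under the link maps. -/
lemma IsExact.eq_zero_of_linkSum_eq_zero (hS : S.IsExact) (hdist : ∀ m, S.Distributive m)
    (m : Multidegree d) (h : (linkSum x m fun _ => True) = 0) (y : Multidegree d) : x y = 0 := by
  have ht := hS.linkSum_onRay_mem hx m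
  have ho := fun (u w : Fin 3) (hu : u ≠ w) => hS.linkSum_inSector_mem hx m hu
  rw [linkSum_true] at h
  have hvo : ∀ w, linkSum x m (InSector w m) ∈ S.vanSum m := fun w => by
    obtain ⟨u, -, hu, -⟩ := exists_ne_ne w
    exact S.van_le_vanSum m u (ho u w hu.symm)
  have hvt : ∀ w, linkSum x m (OnRay w m) ∈ S.vanSum m := fun w => S.van_le_vanSum m w (ht w)
  have hxm : x m = 0 := by
    refine eq_zero_of_mem_vanSum W hdisj hxW ?_
    rw [add_assoc] at h
    rw [eq_neg_of_add_eq_zero_left h]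
    exact neg_mem (add_mem (add_mem (add_mem (hvt 0) (hvt 1)) (hvt 2))
      (add_mem (add_mem (hvo 0) (hvo 1)) (hvo 2)))
  rw [hxm, zero_add] at h
  -- The ray term is minus the others, each of which lies in one of the two remaining `van`: a ray
  -- term in that of its own index, a sector term in that of any index but its own.
  have h0 := hS.linkSum_onRay_eq_zero W hdisj hx hxW hdist (u := 0) (v := 1) (w := 2) (by decide)
    (by decide) (by decide) m hxm (by
      rw [show linkSum x m (OnRay 0 m) = -(linkSum x m (OnRay 1 m) + linkSum x m (InSector 0 m) +
        linkSum x m (InSector 2 m)) + -(linkSum x m (OnRay 2 m) + linkSum x m (InSector 1 m)) by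
        rw [← sub_eq_zero, ← h]; abel]
      exact add_mem (Submodule.mem_sup_left (neg_mem (add_mem (add_mem (ht 1)
        (ho 1 0 (by decide))) (ho 1 2 (by decide)))))
        (Submodule.mem_sup_right (neg_mem (add_mem (ht 2) (ho 2 1 (by decide))))))
  have h1 := hS.linkSum_onRay_eq_zero W hdisj hx hxW hdist (u := 1) (v := 0) (w := 2) (by decide)
    (by decide) (by decide) m hxm (by
      rw [show linkSum x m (OnRay 1 m) = -(linkSum x m (OnRay 0 m) + linkSum x m (InSector 1 m) +
        linkSum x m (InSector 2 m)) + -(linkSum x m (OnRay 2 m) + linkSum x m (InSector 0 m)) by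
        rw [← sub_eq_zero, ← h]; abel]
      exact add_mem (Submodule.mem_sup_left (neg_mem (add_mem (add_mem (ht 0)
        (ho 0 1 (by decide))) (ho 0 2 (by decide)))))
        (Submodule.mem_sup_right (neg_mem (add_mem (ht 2) (ho 2 0 (by decide))))))
  have h2 := hS.linkSum_onRay_eq_zero W hdisj hx hxW hdist (u := 2) (v := 0) (w := 1) (by decide)
    (by decide) (by decide) m hxm (by
      rw [show linkSum x m (OnRay 2 m) = -(linkSum x m (OnRay 0 m) + linkSum x m (InSector 1 m) +
        linkSum x m (InSector 2 m)) + -(linkSum x m (OnRay 1 m) + linkSum x m (InSector 0 m)) by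
        rw [← sub_eq_zero, ← h]; abel]
      exact add_mem (Submodule.mem_sup_left (neg_mem (add_mem (add_mem (ht 0)
        (ho 0 1 (by decide))) (ho 0 2 (by decide)))))
        (Submodule.mem_sup_right (neg_mem (add_mem (ht 1) (ho 1 0 (by decide))))))
  rw [h0.2, h1.2, h2.2, add_zero, add_zero, zero_add] at h
  have hray : ∀ u, linkSum x m (OnRay u m) = 0 := fun u => by
    fin_cases u
    exacts [h0.2, h1.2, h2.2]
  -- Each sector term is minus the sum of the other two, which both vanish on component w; it
  -- therefore vanishes on every component.
  have hsec : ∀ w, linkSum x m (InSector w m) = 0 := by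
    have hz : ∀ w, linkSum x m (InSector w m) ∈ S.van m w := by
      intro w
      fin_cases w
      · have := neg_mem (add_mem (ho 0 1 (by decide)) (ho 0 2 (by decide)))
        rwa [← eq_neg_of_add_eq_zero_left ((add_assoc _ _ _).symm.trans h)] at this
      · have := neg_mem (add_mem (ho 1 0 (by decide)) (ho 1 2 (by decide)))
        rwa [← eq_neg_of_add_eq_zero_left ((add_assoc _ _ _).symm.trans
          ((congrArg (· + _) (add_comm _ _)).trans h))] at this
      · have := neg_mem (add_mem (ho 2 0 (by decide)) (ho 2 1 (by decide)))
        rwa [← eq_neg_of_add_eq_zero_right h] at this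
    intro w
    have hall : ∀ q, linkSum x m (InSector w m) ∈ S.van m q := fun q => by
      by_cases hq : q = w
      · exact hq ▸ hz w
      · exact ho q w hq
    have : linkSum x m (InSector w m) ∈ S.van m 0 ⊓ S.van m 1 ⊓ S.van m 2 :=
      ⟨⟨hall 0, hall 1⟩, hall 2⟩
    rwa [S.van_inf_eq_bot] at this
  obtain ⟨w, hw⟩ := exists_coef_eq_zero y m
  obtain ⟨u, v, hu, hv, huv⟩ := exists_ne_ne w
  refine hS.eq_zero_of_sector W hdisj hx hxW hdist m ?_ y hw
  rw [linkSum_sector x m huv hu.symm hv.symm, hxm, hray, hray, hsec]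
  simp

end Independent

end LimitLinearSeries
end LLS

end

/-! ### From complements to simple bases. -/

noncomputable section

namespace LLS
namespace LimitLinearSeries

variable {k : Type u} [Field k] {C : ChainCurve k} {d r : ℕ} {S : LimitLinearSeries C d r}

/-- The span of those sections of a family that live in degree `m`. -/
def familySpan {n : ℕ} {D : Fin n → Multidegree d} {ρ : Fin n → ℕ}
    (s : ∀ α, Fin (ρ α) → C.H0 (S.L (D α))) (m : Multidegree d) : Submodule k (C.H0 (S.L m)) :=
  Submodule.span k {t | ∃ (α : Fin n) (z : Fin (ρ α)) (h : D α = m), h ▸ s α z = t}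

lemma familySpan_apply {n : ℕ} {D : Fin n → Multidegree d} {ρ : Fin n → ℕ}
    (hD : Function.Injective D) (s : ∀ α, Fin (ρ α) → C.H0 (S.L (D α))) (α : Fin n) :
    familySpan s (D α) = Submodule.span k (Set.range (s α)) := by
  rw [familySpan]
  congr 1
  ext t
  constructor
  · rintro ⟨β, z, h, rfl⟩
    obtain rfl := hD h
    exact ⟨z, rfl⟩
  · rintro ⟨z, rfl⟩
    exact ⟨α, z, rfl, rfl⟩

lemma familySpan_eq_bot {n : ℕ} {D : Fin n → Multidegree d} {ρ : Fin n → ℕ}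
    (s : ∀ α, Fin (ρ α) → C.H0 (S.L (D α))) {m : Multidegree d} (h : m ∉ Set.range D) :
    familySpan s m = ⊥ := by
  rw [familySpan, Submodule.span_eq_bot]
  rintro _ ⟨α, -, hα, -⟩
  exact absurd ⟨α, hα⟩ h

open scoped Classical in
/-- Bases of complements of the `vanSum` form a simple basis. -/
lemma IsExact.isSimpleBasis (hS : S.IsExact) (hdist : ∀ m, S.Distributive m) {n : ℕ}
    {D : Fin n → Multidegree d} {ρ : Fin n → ℕ} {s : ∀ α, Fin (ρ α) → C.H0 (S.L (D α))}
    (hD : Function.Injective D) (hrange : Set.range D = {m | S.vanSum m ≠ S.V m})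
    (hind : ∀ α, LinearIndependent k (s α))
    (hs : ∀ α, Disjoint (S.vanSum (D α)) (Submodule.span k (Set.range (s α))) ∧
      S.vanSum (D α) ⊔ Submodule.span k (Set.range (s α)) = S.V (D α)) :
    S.IsSimpleBasis D ρ s := by
  have hW : ∀ m, Disjoint (S.vanSum m) (familySpan s m) ∧
      S.vanSum m ⊔ familySpan s m = S.V m := by
    intro m
    by_cases hm : m ∈ Set.range D
    · obtain ⟨α, rfl⟩ := hm
      rw [familySpan_apply hD]
      exact hs α
    · rw [familySpan_eq_bot s hm, sup_bot_eq]
      rw [hrange] at hm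
      exact ⟨disjoint_bot_right, not_not.1 hm⟩
  have hmem : ∀ α z, s α z ∈ S.V (D α) := fun α z => by
    rw [← (hs α).2]
    exact Submodule.mem_sup_right (Submodule.subset_span ⟨z, rfl⟩)
  refine ⟨hD, hmem, hind, fun m => ?_, fun m => le_antisymm ?_ ?_⟩
  · rw [Fintype.linearIndependent_iff]
    intro g hg
    let X : ∀ α, C.H0 (S.L (D α)) := fun α => ∑ z, g ⟨α, z⟩ • s α z
    -- A linear relation is regrouped by multidegree: as `D` is injective at most one summand
    -- survives, and outside the range of `D` the value is zero, as it must be where the complement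
    -- is trivial.
    let x : ∀ y, C.H0 (S.L y) := fun y => ∑ α, if h : D α = y then h ▸ X α else 0
    have hxD : ∀ α, x (D α) = X α := fun α => by
      refine (Finset.sum_eq_single α (fun β _ hβ => dif_neg fun h => hβ (hD h)) (by simp)).trans ?_
      simp
    have hx0 : ∀ y, y ∉ Set.range D → x y = 0 := fun y hy =>
      Finset.sum_eq_zero fun α _ => dif_neg fun h => hy ⟨α, h⟩
    have hxW : ∀ y, x y ∈ familySpan s y := by
      intro y
      by_cases hy : y ∈ Set.range D
      · obtain ⟨α, rfl⟩ := hy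
        rw [hxD, familySpan_apply hD]
        exact sum_mem fun z _ => Submodule.smul_mem _ _ (Submodule.subset_span ⟨z, rfl⟩)
      · rw [hx0 y hy]
        exact zero_mem _
    have hxV : ∀ y, x y ∈ S.V y := fun y => (hW y).2 ▸ Submodule.mem_sup_right (hxW y)
    have hsum : (linkSum x m fun _ => True) = 0 := by
      rw [← hg, Fintype.sum_sigma, linkSum]
      simp only [if_true]
      have : Function.support (fun y => S.link y m (x y)) ⊆ Set.range D := fun y hy => by
        by_contra h
        exact hy (by simp [hx0 y h])
      rw [finsum_eq_sum_of_support_subset (s := Finset.univ.image D) _ (by simpa using this),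
        Finset.sum_image fun a _ b _ h => hD h]
      refine Finset.sum_congr rfl fun α _ => ?_
      rw [hxD, map_sum]
      simp
    have h0 := hS.eq_zero_of_linkSum_eq_zero _ (fun m => (hW m).1) hxV hxW hdist m hsum
    rintro ⟨α, z⟩
    exact Fintype.linearIndependent_iff.1 (hind α) (fun z => g ⟨α, z⟩) ((hxD α).symm.trans (h0 _)) z
  · rw [Submodule.span_le]
    rintro _ ⟨⟨α, z⟩, rfl⟩
    exact S.link_mem _ _ (hmem α z)
  · refine (hS.le_linkSpan (fun m => (hW m).2) m).trans (iSup₂_le fun y _ => ?_)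
    rw [familySpan, Submodule.map_span, Submodule.span_le]
    rintro _ ⟨_, ⟨α, z, rfl, rfl⟩, rfl⟩
    exact Submodule.subset_span ⟨⟨α, z⟩, rfl⟩

lemma finiteDimensional (m : Multidegree d) : FiniteDimensional k (S.V m) :=
  Module.finite_of_finrank_pos (by rw [S.finrank_eq]; omega)

lemma IsExact.isSimple (hS : S.IsExact) (hdist : ∀ m, S.Distributive m) : S.IsSimple := by
  classical
  have hfin : Set.Finite {m | S.vanSum m ≠ S.V m} := Set.toFinite _
  obtain ⟨n, D, hD, hrange⟩ := hfin.fin_param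
  have hc : ∀ m, ∃ W : Submodule k (C.H0 (S.L m)), Disjoint (S.vanSum m) W ∧
      S.vanSum m ⊔ W = S.V m := by
    intro m
    obtain ⟨W, hW⟩ := exists_isCompl (S.vanSum m)
    -- A complement in the whole space of sections is cut down to `V m`; the modular law applies
    -- because `vanSum m ≤ V m`.
    refine ⟨W ⊓ S.V m, hW.disjoint.mono_right inf_le_left, ?_⟩
    rw [← sup_inf_assoc_of_le _ (S.vanSum_le m), hW.sup_eq_top, top_inf_eq]
  choose W hW hW' using hc
  have hfd : ∀ m, FiniteDimensional k (W m) := fun m =>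
    have := S.finiteDimensional m
    Submodule.finiteDimensional_of_le (hW' m ▸ le_sup_right)
  let b := fun m => Module.finBasis k (W m)
  have hspan : ∀ m, Submodule.span k (Set.range fun z => (b m z : C.H0 (S.L m))) = W m := by
    intro m
    have := congrArg (Submodule.map (W m).subtype) (b m).span_eq
    rwa [Submodule.map_span, ← Set.range_comp, Submodule.map_top, Submodule.range_subtype] at this
  refine ⟨n, D, _, fun α z => b (D α) z, hS.isSimpleBasis hdist hD hrange (fun α => ?_)
    fun α => ?_⟩
  · exact (b (D α)).linearIndependent.map' (W (D α)).subtype (Submodule.ker_subtype _)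
  · rw [hspan]
    exact ⟨hW _, hW' _⟩

end LimitLinearSeries
end LLS

end

theorem mainTheorem2 {k : Type u} [Field k] [IsAlgClosed k] (C : LLS.ChainCurve k) {d r : ℕ}
    (S : LLS.LimitLinearSeries C d r) (hexact : S.IsExact) (hdist : ∀ m, S.Distributive m) :
    S.IsSimple ∧
    ∀ (n : ℕ) (D : Fin n → LLS.Multidegree d) (ρ : Fin n → ℕ)
      (s : ∀ α, Fin (ρ α) → C.H0 (S.L (D α))),
      Function.Injective D →
      Set.range D = {m | S.vanSum m ≠ S.V m} →
      (∀ α, LinearIndependent k (s α)) →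
      (∀ α, Disjoint (S.vanSum (D α)) (Submodule.span k (Set.range (s α))) ∧
        S.vanSum (D α) ⊔ Submodule.span k (Set.range (s α)) = S.V (D α)) →
      S.IsSimpleBasis D ρ s :=
  ⟨hexact.isSimple hdist, fun _ _ _ _ hD hrange hind hs =>
    hexact.isSimpleBasis hdist hD hrange hind hs⟩
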